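/- **Conventions.** All monoidal categories and monoidal functors are strict; a *CD-category* is a symmetric strict monoidal category with a commutative comonoid (copy, delete) on every object, compatible with $\otimes$; a *hypergraph category* is a CD-category with, in addition, a commutative monoid (compare, omni) on every object, compatible with $\otimes$, such that the laws of special Frobenius algebras hold. CD-functors and hypergraph functors are the strict symmetric monoidal functors preserving this structure. The *graph* of $f\colon X\to Y$ in a hypergraph category is $(\mathrm{id}_X\otimes f)\circ \mathrm{copy}_X\circ \mathrm{omni}_X\colon I\to X\otimes Y$. *Semantics.* Fix an alphabet $U$. $\mathsf{Mat}$ is the hypergraph category whose objects are the finite sets $X$ of finite lists over $U$, all lists in $X$ having the same length, and whose morphisms $X\to Y$ are functions $f\colon Y\times X\to\mathbb R_{\ge 0}$, $(y,x)\mapsto f(y\mid x)$, composed as matrices; on objects $\otimes$ is elementwise concatenation, $I$ contains only the empty list, and on morphisms $\otimes$ is the product of entries; $\mathrm{copy}(y,z\mid x)$ and $\mathrm{compare}(x\mid y,z)$ are $1$ if $x=y=z$ and $0$ otherwise, and $\mathrm{delete}(\,\mid x)=\mathrm{omni}(x\mid\,)=1$. $\mathsf{FinStoch}\subseteq\mathsf{Mat}$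 is the CD-subcategory with all objects and the stochastic matrices ($\sum_y f(y\mid x)=1$ for all $x$). $q\colon\mathsf{Mat}\to\mathsf{FinProjStoch}$ is the quotient identifying $f$ and $\lambda f$ for $\lambda>0$, and $i\colon\mathsf{FinStoch}\to\mathsf{FinProjStoch}$ is the restriction of $q$. *Graphs.* An object of $\mathbf{ODAG}$ is a finite directed graph with a total order on its vertices such that $v\to w$ implies $v<w$; an object of $\mathbf{OUGr}$ is a finite simple undirected graph with a total order on its vertices. Morphisms are monotone maps of vertices which send each edge to an edge or to a single vertex. $\bullet$ is the one-vertex graph. The moralisation $\mathrm{Mor}(\mathcal G)\in\mathbf{OUGr}$ of $\mathcal G\in\mathbf{ODAG}$ has the same vertices and order, and $v\ne w$ are adjacent if there is an edge between them in $\mathcal G$ or if they have a common child. A clique is a non-empty set of pairwise adjacent vertices. *Syntax.* For $\mathcal G\in\mathbf{ODAG}$, $\mathrm{CDSyn}_{\mathcal G}$ and $\mathrm{Syn}_{\mathcal G}$ are the free CD-category and the free hypergraph category with generating objects the vertices and one generator $\mathrm{pa}(v)\to v$ for each vertex $v$ (sets of vertices stand for the tensor product of their elements in increasing order); $\star_{\mathcal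 G}\colon \mathrm{CDSyn}_{\mathcal G}\to\mathrm{Syn}_{\mathcal G}$ is the CD-functor that is the identity on generators. For $\mathcal H\in\mathbf{OUGr}$, $\mathrm{Syn}_{\mathcal H}$ is the free hypergraph category with generating objects the vertices and one generator $I\to C$ for each clique $C$. On $\bullet$, $\star\colon\mathrm{CDSyn}_\bullet\to\mathrm{Syn}_\bullet$ sends the generator $I\to\bullet$ to the generator $I\to\bullet$. The CD-functor $!_{\mathcal G}\colon\mathrm{CDSyn}_\bullet\to\mathrm{CDSyn}_{\mathcal G}$ sends $\bullet$ to the tensor product of all vertices and $I\to\bullet$ to the copy-composition of all generators: in increasing order of $v$, the wires of all smaller vertices are copied, and the generator of $v$ is applied to the copies of its parents, the other copies being deleted. The hypergraph functor $!_{\mathcal H}\colon\mathrm{Syn}_\bullet\to\mathrm{Syn}_{\mathcal H}$ sends $\bullet$ to the tensor product of all vertices and $I\to\bullet$ to the compare-composition of all generators: their tensor product, with all occurrences of the same vertex compared. *Networks.* For CD-functors $\omega,\omega'\colon\mathrm{CDSyn}_\bullet\to\mathsf{FinStoch}$, a distribution-preserving monoidal transformation $\eta\colon\omega\to\omega'$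 is a family of morphisms $\eta_X\colon\omega(X)\to\omega'(X)$ (not necessarily natural) with $\eta_I=\mathrm{id}$, $\eta_{X\otimes Y}=\eta_X\otimes\eta_Y$ and $\eta_\bullet\circ\omega(s)=\omega'(s)$ for the generator $s\colon I\to\bullet$. $\mathbf{BN}$ has as objects the pairs $(\omega,\mathcal G)$ with $\omega = F\circ {!_{\mathcal G}}$ for some CD-functor $F\colon\mathrm{CDSyn}_{\mathcal G}\to\mathsf{FinStoch}$. $\mathbf{MN}$ has as objects the pairs $(\omega,\mathcal H)$ with $$q\circ\Phi\circ{!_{\mathcal H}}\circ\star = i\circ\omega \qquad (*)$$ for some hypergraph functor $\Phi\colon\mathrm{Syn}_{\mathcal H}\to\mathsf{Mat}$. In both categories a morphism from a network on $(\omega,\mathcal K)$ to one on $(\omega',\mathcal K')$ is a pair of a morphism of graphs $\alpha\colon\mathcal K'\to\mathcal K$ and a distribution-preserving monoidal transformation $\eta\colon\omega\to\omega'$; composition is componentwise. **Theorem.** 1. There is a functor $\mathbf{BN}\to\mathbf{MN}$ which sends $(\omega,\mathcal G)$ to $(\omega,\mathrm{Mor}(\mathcal G))$ (in particular, the latter is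 an object of $\mathbf{MN}$), and which sends a morphism $(\alpha,\eta)$ to $(\alpha,\eta)$, where $\alpha\colon\mathcal G'\to\mathcal G$ is regarded as a morphism $\mathrm{Mor}(\mathcal G')\to\mathrm{Mor}(\mathcal G)$. 2. On syntax it is given by precomposition, in the following sense. For every $\mathcal G\in\mathbf{ODAG}$ there is a unique hypergraph functor $m\colon\mathrm{Syn}_{\mathrm{Mor}(\mathcal G)}\to\mathrm{Syn}_{\mathcal G}$ which is the identity on vertices, which sends the generator $I\to C$ to the graph of the generator $\mathrm{pa}(v)\to v$ if $C=\{v\}\cup\mathrm{pa}(v)$ for some vertex $v$, and which sends it to $\mathrm{omni}_C$ for every other clique $C$. It satisfies $$m\circ{!_{\mathrm{Mor}(\mathcal G)}}\circ\star=\star_{\mathcal G}\circ{!_{\mathcal G}}.$$ For every CD-functor $F\colon\mathrm{CDSyn}_{\mathcal G}\to\mathsf{FinStoch}$ there is a unique hypergraph functor $\tilde F\colon\mathrm{Syn}_{\mathcal G}\to\mathsf{Mat}$ such that $\tilde F\circ\star_{\mathcal G}$ is $F$ followed by the inclusion $\mathsf{FinStoch}\subseteq\mathsf{Mat}$; and if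 $\omega=F\circ{!_{\mathcal G}}$, then $(*)$ holds for $\mathcal H=\mathrm{Mor}(\mathcal G)$ and $\Phi=\tilde F\circ m$. -/

import Mathlib

open CategoryTheory MonoidalCategory
open scoped ComonObj MonObj NNReal

universe v v₁ v₂ v₃ u u₁ u₂ u₃ w

namespace PGM

/-! ### Strict monoidal categories, CD-categories and hypergraph categories -/

section General

variable {C : Type u₁} [Category.{v₁} C] {D : Type u₂} [Category.{v₂} D]

/-- Equality of morphisms of a category, including equality of their sources and targets.
(In strict monoidal categories, objects such as `(X ⊗ Y) ⊗ Z` and `X ⊗ (Y ⊗ Z)` are equal, but not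
by definition, so that plain `=` between morphisms is not always available.) -/
def Same {X Y X' Y' : C} (f : X ⟶ Y) (g : X' ⟶ Y') : Prop :=
  Arrow.mk f = Arrow.mk g

theorem same_iff {X Y X' Y' : C} (f : X ⟶ Y) (g : X' ⟶ Y') :
    Same f g ↔ ∃ (hX : X = X') (hY : Y = Y'), f = eqToHom hX ≫ g ≫ eqToHom hY.symm :=
  Arrow.mk_eq_mk_iff f g

theorem Same.refl {X Y : C} (f : X ⟶ Y) : Same f f := rfl

theorem Same.symm {X Y X' Y' : C} {f : X ⟶ Y} {g : X' ⟶ Y'} (h : Same f g) : Same g f :=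
  Eq.symm h

theorem Same.trans {X Y X' Y' X'' Y'' : C} {f : X ⟶ Y} {g : X' ⟶ Y'} {k : X'' ⟶ Y''}
    (h : Same f g) (h' : Same g k) : Same f k :=
  Eq.trans h h'

theorem Same.of_eq {X Y : C} {f g : X ⟶ Y} (h : f = g) : Same f g := by rw [h]; exact Same.refl g

theorem Same.eq {X Y : C} {f g : X ⟶ Y} (h : Same f g) : f = g := by
  obtain ⟨_, _, h⟩ := (same_iff f g).1 h
  simpa using h

theorem Same.comp {X Y Z X' Y' Z' : C} {f : X ⟶ Y} {g : Y ⟶ Z} {f' : X' ⟶ Y'} {g' : Y' ⟶ Z'}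
    (h : Same f f') (k : Same g g') : Same (f ≫ g) (f' ≫ g') := by
  obtain ⟨rfl, rfl, rfl⟩ := (same_iff f f').1 h
  obtain ⟨_, rfl, rfl⟩ := (same_iff g g').1 k
  exact Same.of_eq (by simp)

theorem Same.eqToHom_comp {X X' Y : C} (h : X = X') (f : X' ⟶ Y) : Same (eqToHom h ≫ f) f := by
  subst h; exact Same.of_eq (by simp)

theorem Same.comp_eqToHom {X Y Y' : C} (f : X ⟶ Y) (h : Y = Y') : Same (f ≫ eqToHom h) f := by
  subst h; exact Same.of_eq (by simp)

theorem Same.eqToHom {X Y X' Y' : C} (h : X = Y) (h' : X' = Y') (k : X = X') :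
    Same (eqToHom h) (eqToHom h') := by
  subst h h' k; rfl

theorem Same.map {X Y X' Y' : C} {f : X ⟶ Y} {g : X' ⟶ Y'} (F : C ⥤ D) (h : Same f g) :
    Same (F.map f) (F.map g) := by
  obtain ⟨rfl, rfl, rfl⟩ := (same_iff f g).1 h
  exact Same.of_eq (by simp)

variable [MonoidalCategory C] [MonoidalCategory D]

theorem Same.tensor {X Y X' Y' Z W Z' W' : C} {f : X ⟶ Y} {f' : X' ⟶ Y'} {g : Z ⟶ W}
    {g' : Z' ⟶ W'} (h : Same f f') (k : Same g g') : Same (f ⊗ₘ g) (f' ⊗ₘ g') := by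
  obtain ⟨rfl, rfl, rfl⟩ := (same_iff f f').1 h
  obtain ⟨rfl, rfl, rfl⟩ := (same_iff g g').1 k
  exact Same.of_eq (by simp)

variable (C) in
/-- A monoidal category is strict when its associators and unitors are identities. -/
class StrictMonoidal : Prop where
  tensor_assoc (X Y Z : C) : (X ⊗ Y) ⊗ Z = X ⊗ (Y ⊗ Z)
  unit_tensor (X : C) : 𝟙_ C ⊗ X = X
  tensor_unit (X : C) : X ⊗ 𝟙_ C = X
  associator_eq (X Y Z : C) : (α_ X Y Z).hom = eqToHom (tensor_assoc X Y Z)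
  leftUnitor_eq (X : C) : (λ_ X).hom = eqToHom (unit_tensor X)
  rightUnitor_eq (X : C) : (ρ_ X).hom = eqToHom (tensor_unit X)

theorem associator_inv_eq [StrictMonoidal C] (X Y Z : C) :
    (α_ X Y Z).inv = eqToHom (StrictMonoidal.tensor_assoc X Y Z).symm := by
  rw [← cancel_epi (α_ X Y Z).hom, Iso.hom_inv_id, StrictMonoidal.associator_eq]; simp

theorem leftUnitor_inv_eq [StrictMonoidal C] (X : C) :
    (λ_ X).inv = eqToHom (StrictMonoidal.unit_tensor X).symm := by
  rw [← cancel_epi (λ_ X).hom, Iso.hom_inv_id, StrictMonoidal.leftUnitor_eq]; simp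

theorem rightUnitor_inv_eq [StrictMonoidal C] (X : C) :
    (ρ_ X).inv = eqToHom (StrictMonoidal.tensor_unit X).symm := by
  rw [← cancel_epi (ρ_ X).hom, Iso.hom_inv_id, StrictMonoidal.rightUnitor_eq]; simp

variable (C) in
/-- A hypergraph category: a CD-category (`CopyDiscardCategory`: symmetric monoidal, with a
commutative comonoid on every object, compatible with the tensor product) in which every object
also carries a commutative monoid, compatible with the tensor product, such that comonoid and
monoid satisfy the laws of special Frobenius algebras. The multiplication `μ` is `compare`, the
unit `η` is `omni`. -/
class HypergraphCategory [CopyDiscardCategory C] where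
  [monObj : (X : C) → MonObj X]
  [isCommMonObj : (X : C) → IsCommMonObj X]
  compare_tensor (X Y : C) : μ[X ⊗ Y] = tensorμ X Y X Y ≫ (μ[X] ⊗ₘ μ[Y])
  omni_tensor (X Y : C) : η[X ⊗ Y] = (λ_ (𝟙_ C)).inv ≫ (η[X] ⊗ₘ η[Y])
  compare_unit : μ[𝟙_ C] = (λ_ (𝟙_ C)).hom
  omni_unit : η[𝟙_ C] = 𝟙 (𝟙_ C)
  special (X : C) : Δ[X] ≫ μ[X] = 𝟙 X
  frobenius_left (X : C) : Δ[X] ▷ X ≫ (α_ X X X).hom ≫ X ◁ μ[X] = μ[X] ≫ Δ[X]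
  frobenius_right (X : C) : X ◁ Δ[X] ≫ (α_ X X X).inv ≫ μ[X] ▷ X = μ[X] ≫ Δ[X]

attribute [reducible] HypergraphCategory.monObj
attribute [instance] HypergraphCategory.monObj HypergraphCategory.isCommMonObj

/-- Strict symmetric monoidal functors preserving copy and delete. -/
structure IsCDFunctor [CopyDiscardCategory C] [CopyDiscardCategory D] (F : C ⥤ D) : Prop where
  obj_unit : F.obj (𝟙_ C) = 𝟙_ D
  obj_tensor (X Y : C) : F.obj (X ⊗ Y) = F.obj X ⊗ F.obj Y
  map_tensor {X Y X' Y' : C} (f : X ⟶ Y) (g : X' ⟶ Y') :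
    Same (F.map (f ⊗ₘ g)) (F.map f ⊗ₘ F.map g)
  map_braiding (X Y : C) : Same (F.map (β_ X Y).hom) (β_ (F.obj X) (F.obj Y)).hom
  map_copy (X : C) : Same (F.map Δ[X]) Δ[F.obj X]
  map_delete (X : C) : Same (F.map ε[X]) ε[F.obj X]

/-- CD-functors which preserve compare and omni. -/
structure IsHypergraphFunctor [CopyDiscardCategory C] [CopyDiscardCategory D]
    [HypergraphCategory C] [HypergraphCategory D] (F : C ⥤ D) : Prop extends IsCDFunctor F where
  map_compare (X : C) : Same (F.map μ[X]) μ[F.obj X]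
  map_omni (X : C) : Same (F.map η[X]) η[F.obj X]

end General

/-- Bundled CD-functors. -/
structure CDFunctor (C : Type u₁) [Category.{v₁} C] [MonoidalCategory C] [CopyDiscardCategory C]
    (D : Type u₂) [Category.{v₂} D] [MonoidalCategory D] [CopyDiscardCategory D]
    extends C ⥤ D where
  isCD : IsCDFunctor toFunctor

/-- Bundled hypergraph functors. -/
structure HypergraphFunctor (C : Type u₁) [Category.{v₁} C] [MonoidalCategory C]
    [CopyDiscardCategory C] [HypergraphCategory C]
    (D : Type u₂) [Category.{v₂} D] [MonoidalCategory D] [CopyDiscardCategory D]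
    [HypergraphCategory D] extends C ⥤ D where
  isHypergraph : IsHypergraphFunctor toFunctor

namespace HypergraphFunctor

variable {C : Type u₁} [Category.{v₁} C] [MonoidalCategory C] [CopyDiscardCategory C]
  [HypergraphCategory C] {D : Type u₂} [Category.{v₂} D] [MonoidalCategory D]
  [CopyDiscardCategory D] [HypergraphCategory D] {E : Type u₃} [Category.{v₃} E]
  [MonoidalCategory E] [CopyDiscardCategory E] [HypergraphCategory E]

/-- Composition of hypergraph functors. -/
def comp (F : HypergraphFunctor C D) (G : HypergraphFunctor D E) : HypergraphFunctor C E where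
  toFunctor := F.toFunctor ⋙ G.toFunctor
  isHypergraph :=
    { obj_unit := (congrArg G.obj F.isHypergraph.obj_unit).trans G.isHypergraph.obj_unit
      obj_tensor := fun X Y =>
        (congrArg G.obj (F.isHypergraph.obj_tensor X Y)).trans (G.isHypergraph.obj_tensor _ _)
      map_tensor := fun f g => ((F.isHypergraph.map_tensor f g).map G.toFunctor).trans
        (G.isHypergraph.map_tensor _ _)
      map_braiding := fun X Y => ((F.isHypergraph.map_braiding X Y).map G.toFunctor).trans
        (G.isHypergraph.map_braiding _ _)
      map_copy := fun X => ((F.isHypergraph.map_copy X).map G.toFunctor).trans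
        (G.isHypergraph.map_copy _)
      map_delete := fun X => ((F.isHypergraph.map_delete X).map G.toFunctor).trans
        (G.isHypergraph.map_delete _)
      map_compare := fun X => ((F.isHypergraph.map_compare X).map G.toFunctor).trans
        (G.isHypergraph.map_compare _)
      map_omni := fun X => ((F.isHypergraph.map_omni X).map G.toFunctor).trans
        (G.isHypergraph.map_omni _) }

end HypergraphFunctor

section Graphs

variable {C : Type u₁} [Category.{v₁} C] [MonoidalCategory C] [CopyDiscardCategory C]
  [HypergraphCategory C]

/-- The graph of `f : X ⟶ Y`: the morphism `I ⟶ X ⊗ Y` obtained by bending the input of `f` with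
the morphism `I ⟶ X ⊗ X` given by omni followed by copy. -/
def graph {X Y : C} (f : X ⟶ Y) : 𝟙_ C ⟶ X ⊗ Y :=
  η[X] ≫ Δ[X] ≫ (𝟙 X ⊗ₘ f)

theorem conv_comm {X Y : C} (f g : X ⟶ Y) :
    Δ[X] ≫ f ▷ X ≫ Y ◁ g ≫ μ[Y] = Δ[X] ≫ g ▷ X ≫ Y ◁ f ≫ μ[Y] := by
  have h (a b : X ⟶ Y) : Δ[X] ≫ a ▷ X ≫ Y ◁ b ≫ μ[Y] = Δ[X] ≫ (a ⊗ₘ b) ≫ μ[Y] := by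
    simp [MonoidalCategory.tensorHom_def]
  rw [h, h]
  conv_lhs => rw [← IsCommComonObj.comul_comm X]
  conv_rhs => rw [← IsCommMonObj.mul_comm Y]
  rw [Category.assoc, ← BraidedCategory.braiding_naturality_assoc]

/-- The convolution product of morphisms `X ⟶ Y` is commutative. For `X` the monoidal unit, this
product takes two morphisms `I ⟶ Y` to their tensor product followed by compare, and its neutral
element is omni. -/
instance convCommMonoid (X Y : C) : CommMonoid (Conv X Y) where
  mul_comm f g := conv_comm (C := C) f g

end Graphs

/-! ### Free CD-categories and free hypergraph categories -/

/-- A monoidal signature: generating objects, and generating morphisms typed by finite lists of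
generating objects. -/
structure Signature where
  Ob : Type u
  Gen : Type u
  src : Gen → List Ob
  tgt : Gen → List Ob

/-- Terms for morphisms of the free CD-category (`hyp` false) or of the free hypergraph category
(`hyp` true) on a signature: compare and omni are available only in the second case. The
constructor `cast` gives the identities (between equal, not only definitionally equal, lists).
Structural morphisms are available on all lists; the compatibilities with the tensor product in
`FreeRel` reduce them to those on generating objects. -/
inductive FreeTerm (S : Signature.{u}) (hyp : Prop) : List S.Ob → List S.Ob → Type u
  | cast {X Y : List S.Ob} (h : X = Y) : FreeTerm S hyp X Y
  | comp {X Y Z : List S.Ob} (f : FreeTerm S hyp X Y) (g : FreeTerm S hyp Y Z) : FreeTerm S hyp X Z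
  | tensor {X Y X' Y' : List S.Ob} (f : FreeTerm S hyp X Y) (g : FreeTerm S hyp X' Y') :
      FreeTerm S hyp (X ++ X') (Y ++ Y')
  | braid (X Y : List S.Ob) : FreeTerm S hyp (X ++ Y) (Y ++ X)
  | copy (X : List S.Ob) : FreeTerm S hyp X (X ++ X)
  | delete (X : List S.Ob) : FreeTerm S hyp X []
  | compare (h : hyp) (X : List S.Ob) : FreeTerm S hyp (X ++ X) X
  | omni (h : hyp) (X : List S.Ob) : FreeTerm S hyp [] X
  | gen (s : S.Gen) : FreeTerm S hyp (S.src s) (S.tgt s)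

namespace FreeTerm

variable {S : Signature.{u}} {hyp : Prop}

/-- Identity term. -/
abbrev id (X : List S.Ob) : FreeTerm S hyp X X := cast rfl

/-- Interchange of the two middle factors. -/
abbrev middle (X₁ X₂ Y₁ Y₂ : List S.Ob) :
    FreeTerm S hyp ((X₁ ++ X₂) ++ (Y₁ ++ Y₂)) ((X₁ ++ Y₁) ++ (X₂ ++ Y₂)) :=
  comp (cast (List.append_assoc X₁ X₂ (Y₁ ++ Y₂))) <|
  comp (tensor (id X₁) (cast (List.append_assoc X₂ Y₁ Y₂).symm)) <|
  comp (tensor (id X₁) (tensor (braid X₂ Y₁) (id Y₂))) <|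
  comp (tensor (id X₁) (cast (List.append_assoc Y₁ X₂ Y₂)))
    (cast (List.append_assoc X₁ Y₁ (X₂ ++ Y₂)).symm)

end FreeTerm

open FreeTerm in
/-- The laws of strict CD-categories and, where compare and omni are available, of strict
hypergraph categories. -/
inductive FreeRel (S : Signature.{u}) (hyp : Prop) :
    {X Y : List S.Ob} → FreeTerm S hyp X Y → FreeTerm S hyp X Y → Prop
  -- congruence
  | comp_left {X Y Z : List S.Ob} {f f' : FreeTerm S hyp X Y} (g : FreeTerm S hyp Y Z) :
      FreeRel S hyp f f' → FreeRel S hyp (comp f g) (comp f' g)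
  | comp_right {X Y Z : List S.Ob} (f : FreeTerm S hyp X Y) {g g' : FreeTerm S hyp Y Z} :
      FreeRel S hyp g g' → FreeRel S hyp (comp f g) (comp f g')
  | tensor_left {X Y X' Y' : List S.Ob} {f f' : FreeTerm S hyp X Y} (g : FreeTerm S hyp X' Y') :
      FreeRel S hyp f f' → FreeRel S hyp (tensor f g) (tensor f' g)
  | tensor_right {X Y X' Y' : List S.Ob} (f : FreeTerm S hyp X Y) {g g' : FreeTerm S hyp X' Y'} :
      FreeRel S hyp g g' → FreeRel S hyp (tensor f g) (tensor f g')
  -- strict monoidal categories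
  | id_comp {X Y : List S.Ob} (f : FreeTerm S hyp X Y) : FreeRel S hyp (comp (id X) f) f
  | comp_id {X Y : List S.Ob} (f : FreeTerm S hyp X Y) : FreeRel S hyp (comp f (id Y)) f
  | assoc {X Y Z W : List S.Ob} (f : FreeTerm S hyp X Y) (g : FreeTerm S hyp Y Z)
      (h : FreeTerm S hyp Z W) : FreeRel S hyp (comp (comp f g) h) (comp f (comp g h))
  | tensor_id (X Y : List S.Ob) : FreeRel S hyp (tensor (id X) (id Y)) (id (X ++ Y))
  | tensor_comp {X Y Z X' Y' Z' : List S.Ob} (f : FreeTerm S hyp X Y) (f' : FreeTerm S hyp X' Y')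
      (g : FreeTerm S hyp Y Z) (g' : FreeTerm S hyp Y' Z') :
      FreeRel S hyp (comp (tensor f f') (tensor g g')) (tensor (comp f g) (comp f' g'))
  | tensor_assoc {X₁ X₂ X₃ Y₁ Y₂ Y₃ : List S.Ob} (f₁ : FreeTerm S hyp X₁ Y₁)
      (f₂ : FreeTerm S hyp X₂ Y₂) (f₃ : FreeTerm S hyp X₃ Y₃) :
      FreeRel S hyp
        (comp (tensor (tensor f₁ f₂) f₃) (cast (List.append_assoc Y₁ Y₂ Y₃)))
        (comp (cast (List.append_assoc X₁ X₂ X₃)) (tensor f₁ (tensor f₂ f₃)))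
  | unit_tensor {X Y : List S.Ob} (f : FreeTerm S hyp X Y) : FreeRel S hyp (tensor (id []) f) f
  | tensor_unit {X Y : List S.Ob} (f : FreeTerm S hyp X Y) :
      FreeRel S hyp (comp (tensor f (id [])) (cast (List.append_nil Y)))
        (comp (cast (List.append_nil X)) f)
  -- symmetry
  | braid_natural {X Y X' Y' : List S.Ob} (f : FreeTerm S hyp X Y) (g : FreeTerm S hyp X' Y') :
      FreeRel S hyp (comp (tensor f g) (braid Y Y')) (comp (braid X X') (tensor g f))
  | symmetry (X Y : List S.Ob) : FreeRel S hyp (comp (braid X Y) (braid Y X)) (id (X ++ Y))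
  | hexagon_forward (X Y Z : List S.Ob) :
      FreeRel S hyp
        (comp (cast (List.append_assoc X Y Z))
          (comp (braid X (Y ++ Z)) (cast (List.append_assoc Y Z X))))
        (comp (tensor (braid X Y) (id Z))
          (comp (cast (List.append_assoc Y X Z)) (tensor (id Y) (braid X Z))))
  | hexagon_reverse (X Y Z : List S.Ob) :
      FreeRel S hyp
        (comp (cast (List.append_assoc X Y Z).symm)
          (comp (braid (X ++ Y) Z) (cast (List.append_assoc Z X Y).symm)))
        (comp (tensor (id X) (braid Y Z))
          (comp (cast (List.append_assoc X Z Y).symm) (tensor (braid X Z) (id Y))))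
  -- commutative comonoids
  | copy_comm (X : List S.Ob) : FreeRel S hyp (comp (copy X) (braid X X)) (copy X)
  | copy_assoc (X : List S.Ob) :
      FreeRel S hyp (comp (copy X) (tensor (id X) (copy X)))
        (comp (copy X) (comp (tensor (copy X) (id X)) (cast (List.append_assoc X X X))))
  | delete_copy (X : List S.Ob) :
      FreeRel S hyp (comp (copy X) (tensor (delete X) (id X))) (id X)
  | copy_delete (X : List S.Ob) :
      FreeRel S hyp (comp (copy X) (tensor (id X) (delete X))) (cast (List.append_nil X).symm)
  | copy_tensor (X Y : List S.Ob) :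
      FreeRel S hyp (copy (X ++ Y)) (comp (tensor (copy X) (copy Y)) (middle X X Y Y))
  | delete_tensor (X Y : List S.Ob) :
      FreeRel S hyp (delete (X ++ Y)) (tensor (delete X) (delete Y))
  | copy_nil : FreeRel S hyp (copy []) (id [])
  | delete_nil : FreeRel S hyp (delete []) (id [])
  -- commutative monoids
  | compare_comm (h : hyp) (X : List S.Ob) :
      FreeRel S hyp (comp (braid X X) (compare h X)) (compare h X)
  | compare_assoc (h : hyp) (X : List S.Ob) :
      FreeRel S hyp (comp (tensor (compare h X) (id X)) (compare h X))
        (comp (cast (List.append_assoc X X X)) (comp (tensor (id X) (compare h X)) (compare h X)))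
  | omni_compare (h : hyp) (X : List S.Ob) :
      FreeRel S hyp (comp (tensor (omni h X) (id X)) (compare h X)) (id X)
  | compare_omni (h : hyp) (X : List S.Ob) :
      FreeRel S hyp (comp (tensor (id X) (omni h X)) (compare h X)) (cast (List.append_nil X))
  | compare_tensor (h : hyp) (X Y : List S.Ob) :
      FreeRel S hyp (compare h (X ++ Y))
        (comp (middle X Y X Y) (tensor (compare h X) (compare h Y)))
  | omni_tensor (h : hyp) (X Y : List S.Ob) :
      FreeRel S hyp (omni h (X ++ Y)) (tensor (omni h X) (omni h Y))
  | compare_nil (h : hyp) : FreeRel S hyp (compare h []) (id [])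
  | omni_nil (h : hyp) : FreeRel S hyp (omni h []) (id [])
  -- special Frobenius algebras
  | special (h : hyp) (X : List S.Ob) : FreeRel S hyp (comp (copy X) (compare h X)) (id X)
  | frobenius_left (h : hyp) (X : List S.Ob) :
      FreeRel S hyp
        (comp (tensor (copy X) (id X))
          (comp (cast (List.append_assoc X X X)) (tensor (id X) (compare h X))))
        (comp (compare h X) (copy X))
  | frobenius_right (h : hyp) (X : List S.Ob) :
      FreeRel S hyp
        (comp (tensor (id X) (copy X))
          (comp (cast (List.append_assoc X X X).symm) (tensor (compare h X) (id X))))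
        (comp (compare h X) (copy X))

/-- The free CD-category (`hyp` false) or free hypergraph category (`hyp` true) on a signature:
objects are finite lists of generating objects. -/
@[ext]
structure FreeStr (S : Signature.{u}) (hyp : Prop) where
  of : List S.Ob

namespace FreeStr

variable {S : Signature.{u}} {hyp : Prop}

/-- Morphisms are terms modulo the laws. -/
def Hom (X Y : FreeStr S hyp) : Type u :=
  Quot (FreeRel S hyp (X := X.of) (Y := Y.of))

/-- The morphism denoted by a term. -/
def ofTerm {X Y : FreeStr S hyp} (f : FreeTerm S hyp X.of Y.of) : Hom X Y := Quot.mk _ f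

theorem sound {X Y : FreeStr S hyp} {f g : FreeTerm S hyp X.of Y.of} (h : FreeRel S hyp f g) :
    (ofTerm f : Hom X Y) = ofTerm g := Quot.sound h

instance : Category.{u} (FreeStr S hyp) where
  Hom := Hom
  id X := ofTerm (FreeTerm.id X.of)
  comp := Quot.map₂ FreeTerm.comp (fun f _ _ h => .comp_right f h) (fun _ _ g h => .comp_left g h)
  id_comp := by rintro X Y ⟨f⟩; exact sound (FreeRel.id_comp f)
  comp_id := by rintro X Y ⟨f⟩; exact sound (FreeRel.comp_id f)
  assoc := by rintro X Y Z W ⟨f⟩ ⟨g⟩ ⟨h⟩; exact sound (FreeRel.assoc f g h)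

/-- Isomorphism between equal objects. -/
def castIso {X Y : FreeStr S hyp} (h : X.of = Y.of) : X ≅ Y where
  hom := ofTerm (FreeTerm.cast h)
  inv := ofTerm (FreeTerm.cast h.symm)
  hom_inv_id := by
    obtain ⟨X⟩ := X; obtain ⟨Y⟩ := Y; cases h; exact sound (FreeRel.id_comp _)
  inv_hom_id := by
    obtain ⟨X⟩ := X; obtain ⟨Y⟩ := Y; cases h; exact sound (FreeRel.id_comp _)

theorem castIso_hom {X Y : FreeStr S hyp} (h : X = Y) :
    (castIso (congrArg of h)).hom = eqToHom h := by
  cases h; rfl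

theorem castIso_inv {X Y : FreeStr S hyp} (h : Y = X) :
    (castIso (congrArg of h).symm).hom = eqToHom h.symm := by
  cases h; rfl

instance : MonoidalCategoryStruct (FreeStr S hyp) where
  tensorObj X Y := ⟨X.of ++ Y.of⟩
  tensorHom := Quot.map₂ FreeTerm.tensor (fun f _ _ h => .tensor_right f h)
    (fun _ _ g h => .tensor_left g h)
  whiskerLeft X _ _ :=
    Quot.map (FreeTerm.tensor (FreeTerm.id X.of)) (fun _ _ h => .tensor_right _ h)
  whiskerRight f Y :=
    Quot.map (fun f => FreeTerm.tensor f (FreeTerm.id Y.of)) (fun _ _ h => .tensor_left _ h) f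
  tensorUnit := ⟨[]⟩
  associator X Y Z := castIso (List.append_assoc X.of Y.of Z.of)
  leftUnitor _ := castIso rfl
  rightUnitor X := castIso (List.append_nil X.of)

theorem eqToHom_tensor {X X' Y Y' : FreeStr S hyp} (h : X = X') (k : Y = Y') :
    (eqToHom h ⊗ₘ eqToHom k) = eqToHom (congrArg₂ tensorObj h k) := by
  subst h k; exact sound (FreeRel.tensor_id _ _)

theorem associator_eq (X Y Z : FreeStr S hyp) : (α_ X Y Z).hom =
    eqToHom (FreeStr.ext (List.append_assoc X.of Y.of Z.of) : (X ⊗ Y) ⊗ Z = X ⊗ (Y ⊗ Z)) :=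
  castIso_hom _

theorem leftUnitor_eq (X : FreeStr S hyp) : (λ_ X).hom = eqToHom (rfl : 𝟙_ _ ⊗ X = X) :=
  castIso_hom (X := 𝟙_ _ ⊗ X) (Y := X) rfl

theorem rightUnitor_eq (X : FreeStr S hyp) :
    (ρ_ X).hom = eqToHom (FreeStr.ext (List.append_nil X.of) : X ⊗ 𝟙_ _ = X) :=
  castIso_hom _

instance : MonoidalCategory (FreeStr S hyp) :=
  MonoidalCategory.ofTensorHom
    (id_tensorHom_id := fun _ _ => sound (FreeRel.tensor_id _ _))
    (id_tensorHom := by rintro X Y Z ⟨f⟩; rfl)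
    (tensorHom_id := by rintro X Y ⟨f⟩ Z; rfl)
    (tensorHom_comp_tensorHom := by
      rintro _ _ _ _ _ _ ⟨f⟩ ⟨f'⟩ ⟨g⟩ ⟨g'⟩; exact sound (FreeRel.tensor_comp f f' g g'))
    (associator_naturality := by
      rintro _ _ _ _ _ _ ⟨f⟩ ⟨g⟩ ⟨h⟩; exact sound (FreeRel.tensor_assoc f g h))
    (leftUnitor_naturality := by
      rintro X Y ⟨f⟩
      exact (sound (FreeRel.comp_id _)).trans
        ((sound (FreeRel.unit_tensor f)).trans (sound (FreeRel.id_comp _)).symm))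
    (rightUnitor_naturality := by rintro X Y ⟨f⟩; exact sound (FreeRel.tensor_unit f))
    (pentagon := fun W X Y Z => by
      rw [associator_eq, associator_eq, associator_eq, associator_eq, associator_eq,
        ← eqToHom_refl _ rfl, ← eqToHom_refl _ rfl, eqToHom_tensor, eqToHom_tensor]
      simp)
    (triangle := fun X Y => by
      rw [associator_eq, leftUnitor_eq, rightUnitor_eq,
        ← eqToHom_refl _ rfl, ← eqToHom_refl _ rfl, eqToHom_tensor, eqToHom_tensor]
      simp)

instance : StrictMonoidal (FreeStr S hyp) where
  tensor_assoc X Y Z := FreeStr.ext (List.append_assoc X.of Y.of Z.of)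
  unit_tensor _ := rfl
  tensor_unit X := FreeStr.ext (List.append_nil X.of)
  associator_eq := associator_eq
  leftUnitor_eq := leftUnitor_eq
  rightUnitor_eq := rightUnitor_eq

instance : SymmetricCategory (FreeStr S hyp) where
  braiding X Y :=
    { hom := ofTerm (FreeTerm.braid X.of Y.of)
      inv := ofTerm (FreeTerm.braid Y.of X.of)
      hom_inv_id := sound (FreeRel.symmetry _ _)
      inv_hom_id := sound (FreeRel.symmetry _ _) }
  braiding_naturality_right := by rintro X Y Z ⟨f⟩; exact sound (FreeRel.braid_natural _ _)
  braiding_naturality_left := by rintro X Y ⟨f⟩ Z; exact sound (FreeRel.braid_natural _ _)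
  hexagon_forward _ _ _ := sound (FreeRel.hexagon_forward _ _ _)
  hexagon_reverse _ _ _ := sound (FreeRel.hexagon_reverse _ _ _)
  symmetry _ _ := sound (FreeRel.symmetry _ _)

instance (X : FreeStr S hyp) : ComonObj X where
  counit := ofTerm (Y := 𝟙_ _) (FreeTerm.delete X.of)
  comul := ofTerm (Y := X ⊗ X) (FreeTerm.copy X.of)
  counit_comul := sound (FreeRel.delete_copy _)
  comul_counit := sound (FreeRel.copy_delete _)
  comul_assoc := sound (FreeRel.copy_assoc _)

instance (X : FreeStr S hyp) : IsCommComonObj X where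
  comul_comm := sound (FreeRel.copy_comm _)

instance : CopyDiscardCategory (FreeStr S hyp) where
  copy_tensor _ _ := sound (FreeRel.copy_tensor _ _)
  discard_tensor _ _ := (sound (FreeRel.delete_tensor _ _)).trans (sound (FreeRel.comp_id _)).symm
  copy_unit := sound FreeRel.copy_nil
  discard_unit := sound FreeRel.delete_nil

instance (X : FreeStr S True) : MonObj X where
  one := ofTerm (X := 𝟙_ _) (FreeTerm.omni trivial X.of)
  mul := ofTerm (X := X ⊗ X) (FreeTerm.compare trivial X.of)
  one_mul := sound (FreeRel.omni_compare _ _)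
  mul_one := sound (FreeRel.compare_omni _ _)
  mul_assoc := sound (FreeRel.compare_assoc _ _)

instance (X : FreeStr S True) : IsCommMonObj X where
  mul_comm := sound (FreeRel.compare_comm _ _)

instance : HypergraphCategory (FreeStr S True) where
  compare_tensor _ _ := sound (FreeRel.compare_tensor _ _ _)
  omni_tensor _ _ := (sound (FreeRel.omni_tensor _ _ _)).trans (sound (FreeRel.id_comp _)).symm
  compare_unit := sound (FreeRel.compare_nil _)
  omni_unit := sound (FreeRel.omni_nil _)
  special _ := sound (FreeRel.special _ _)
  frobenius_left _ := sound (FreeRel.frobenius_left _ _)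
  frobenius_right _ := sound (FreeRel.frobenius_right _ _)

/-- The generating morphism `s`. -/
def gen (hyp : Prop) (s : S.Gen) : (⟨S.src s⟩ : FreeStr S hyp) ⟶ ⟨S.tgt s⟩ :=
  ofTerm (FreeTerm.gen s)

end FreeStr

section Lift

variable {S : Signature.{u}} {hyp : Prop} {D : Type u₂} [Category.{v₂} D] [MonoidalCategory D]

section Obj

variable (o : S.Ob → D)

/-- The tensor product of the values of `o` on a list of generating objects. -/
def liftObj : List S.Ob → D
  | [] => 𝟙_ D
  | a :: X => o a ⊗ liftObj X

variable [StrictMonoidal D]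

theorem liftObj_append (X Y : List S.Ob) : liftObj o (X ++ Y) = liftObj o X ⊗ liftObj o Y := by
  induction X with
  | nil => exact (StrictMonoidal.unit_tensor _).symm
  | cons a X ih => simp only [List.cons_append, liftObj, ih, StrictMonoidal.tensor_assoc]

theorem liftObj_singleton (a : S.Ob) : liftObj o [a] = o a := StrictMonoidal.tensor_unit _

end Obj

variable [StrictMonoidal D] [CopyDiscardCategory D] (H : hyp → HypergraphCategory D)
  (o : S.Ob → D) (g : (s : S.Gen) → (liftObj o (S.src s) ⟶ liftObj o (S.tgt s)))

/-- Interpretation of terms in a strict CD-category or hypergraph category, determined by the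
interpretations of the generating objects and of the generating morphisms. -/
def liftTerm : {X Y : List S.Ob} → FreeTerm S hyp X Y → (liftObj o X ⟶ liftObj o Y)
  | _, _, .cast h => eqToHom (congrArg _ h)
  | _, _, .comp f f' => liftTerm f ≫ liftTerm f'
  | _, _, .tensor f f' =>
      eqToHom (liftObj_append o _ _) ≫ (liftTerm f ⊗ₘ liftTerm f') ≫
        eqToHom (liftObj_append o _ _).symm
  | _, _, .braid X Y =>
      eqToHom (liftObj_append o _ _) ≫ (β_ (liftObj o X) (liftObj o Y)).hom ≫
        eqToHom (liftObj_append o _ _).symm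
  | _, _, .copy X => Δ[liftObj o X] ≫ eqToHom (liftObj_append o _ _).symm
  | _, _, .delete X => ε[liftObj o X]
  | _, _, .compare h X =>
      letI := H h
      eqToHom (liftObj_append o _ _) ≫ μ[liftObj o X]
  | _, _, .omni h X =>
      letI := H h
      η[liftObj o X]
  | _, _, .gen s => g s

theorem same_cast {X Y : List S.Ob} (h : X = Y) {X' Y' : D} (f : X' ⟶ Y') (k : X' = Y')
    (hf : f = eqToHom k) (hX : liftObj o X = X') :
    Same (liftTerm H o g (.cast h)) f := by
  subst hf; exact Same.eqToHom _ _ hX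

theorem same_id {X : List S.Ob} {X' : D} (hX : liftObj o X = X') :
    Same (liftTerm H o g (.cast (rfl : X = X))) (𝟙 X') :=
  same_cast H o g rfl _ rfl rfl hX

theorem same_tensor {X Y X' Y' : List S.Ob} {f : FreeTerm S hyp X Y} {f' : FreeTerm S hyp X' Y'}
    {A B A' B' : D} {k : A ⟶ B} {k' : A' ⟶ B'} (h : Same (liftTerm H o g f) k)
    (h' : Same (liftTerm H o g f') k') : Same (liftTerm H o g (.tensor f f')) (k ⊗ₘ k') :=
  (Same.eqToHom_comp _ _).trans ((Same.comp_eqToHom _ _).trans (h.tensor h'))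

theorem same_comp {X Y Z : List S.Ob} {f : FreeTerm S hyp X Y} {f' : FreeTerm S hyp Y Z}
    {A B C : D} {k : A ⟶ B} {k' : B ⟶ C} (h : Same (liftTerm H o g f) k)
    (h' : Same (liftTerm H o g f') k') : Same (liftTerm H o g (.comp f f')) (k ≫ k') :=
  h.comp h'

theorem same_braid {X Y : List S.Ob} {A B : D} (h : liftObj o X = A) (h' : liftObj o Y = B) :
    Same (liftTerm H o g (.braid X Y)) (β_ A B).hom := by
  subst h h'
  exact (Same.eqToHom_comp _ _).trans (Same.comp_eqToHom _ _)

theorem same_copy {X : List S.Ob} {A : D} (h : liftObj o X = A) :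
    Same (liftTerm H o g (.copy X)) Δ[A] := by
  subst h
  exact Same.comp_eqToHom _ _

theorem same_delete {X : List S.Ob} {A : D} (h : liftObj o X = A) :
    Same (liftTerm H o g (.delete X)) ε[A] := by
  subst h; rfl

theorem same_compare {X : List S.Ob} {A : D} (h : hyp) (hA : liftObj o X = A) :
    letI := H h
    Same (liftTerm H o g (.compare h X)) μ[A] := by
  subst hA
  exact Same.eqToHom_comp _ _

theorem same_omni {X : List S.Ob} {A : D} (h : hyp) (hA : liftObj o X = A) :
    letI := H h
    Same (liftTerm H o g (.omni h X)) η[A] := by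
  subst hA; rfl

theorem same_assoc {X Y Z : List S.Ob} {A B C : D} (hA : liftObj o X = A) (hB : liftObj o Y = B)
    (hC : liftObj o Z = C) :
    Same (liftTerm H o g (.cast (List.append_assoc X Y Z))) (α_ A B C).hom := by
  subst hA hB hC
  exact same_cast H o g _ _ _ (StrictMonoidal.associator_eq _ _ _) (by simp only [liftObj_append])

theorem same_assoc_inv {X Y Z : List S.Ob} {A B C : D} (hA : liftObj o X = A)
    (hB : liftObj o Y = B) (hC : liftObj o Z = C) :
    Same (liftTerm H o g (.cast (List.append_assoc X Y Z).symm)) (α_ A B C).inv := by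
  subst hA hB hC
  exact same_cast H o g _ _ _ (associator_inv_eq _ _ _) (by simp only [liftObj_append])

theorem same_whiskerLeft {X Y X' : List S.Ob} {f : FreeTerm S hyp X Y}
    {A B A' : D} {k : A ⟶ B} (h : Same (liftTerm H o g f) k) (h' : liftObj o X' = A') :
    Same (liftTerm H o g (.tensor (.id X') f)) (A' ◁ k) := by
  rw [← id_tensorHom]
  exact same_tensor H o g (same_id H o g h') h

theorem same_whiskerRight {X Y X' : List S.Ob} {f : FreeTerm S hyp X Y}
    {A B A' : D} {k : A ⟶ B} (h : Same (liftTerm H o g f) k) (h' : liftObj o X' = A') :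
    Same (liftTerm H o g (.tensor f (.id X'))) (k ▷ A') := by
  rw [← tensorHom_id]
  exact same_tensor H o g h (same_id H o g h')

theorem same_middle {X₁ X₂ Y₁ Y₂ : List S.Ob} {A₁ A₂ B₁ B₂ : D} (h₁ : liftObj o X₁ = A₁)
    (h₂ : liftObj o X₂ = A₂) (k₁ : liftObj o Y₁ = B₁) (k₂ : liftObj o Y₂ = B₂) :
    Same (liftTerm H o g (.middle X₁ X₂ Y₁ Y₂)) (tensorμ A₁ A₂ B₁ B₂) :=
  same_comp H o g (same_assoc H o g h₁ h₂ (by subst k₁ k₂; exact liftObj_append o _ _)) <|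
  same_comp H o g (same_whiskerLeft H o g (same_assoc_inv H o g h₂ k₁ k₂) h₁) <|
  same_comp H o g (same_whiskerLeft H o g (same_whiskerRight H o g
    (same_braid H o g h₂ k₁) k₂) h₁) <|
  same_comp H o g (same_whiskerLeft H o g (same_assoc H o g k₁ h₂ k₂) h₁)
    (same_assoc_inv H o g h₁ k₁ (by subst h₂ k₂; exact liftObj_append o _ _))

theorem same_rightUnitor {X : List S.Ob} {A : D} (hA : liftObj o X = A) :
    Same (liftTerm H o g (.cast (List.append_nil X))) (ρ_ A).hom := by
  subst hA
  exact same_cast H o g _ _ _ (StrictMonoidal.rightUnitor_eq _) (liftObj_append o _ _)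

theorem same_rightUnitor_inv {X : List S.Ob} {A : D} (hA : liftObj o X = A) :
    Same (liftTerm H o g (.cast (List.append_nil X).symm)) (ρ_ A).inv := by
  subst hA
  exact same_cast H o g _ _ _ (rightUnitor_inv_eq _) rfl

theorem same_leftUnitor {X : List S.Ob} {A : D} (hA : liftObj o X = A) :
    Same (liftTerm H o g (.id X)) (λ_ A).hom := by
  subst hA
  exact same_cast H o g _ _ _ (StrictMonoidal.leftUnitor_eq _)
    (StrictMonoidal.unit_tensor _).symm

theorem same_leftUnitor_inv {X : List S.Ob} {A : D} (hA : liftObj o X = A) :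
    Same (liftTerm H o g (.id X)) (λ_ A).inv := by
  subst hA
  exact same_cast H o g _ _ _ (leftUnitor_inv_eq _) rfl

theorem eq_of_same {X Y : List S.Ob} {f f' : FreeTerm S hyp X Y} {A B : D} {k k' : A ⟶ B}
    (e : k = k') (h₁ : Same (liftTerm H o g f) k) (h₂ : Same (liftTerm H o g f') k') :
    liftTerm H o g f = liftTerm H o g f' := by
  subst e; exact (h₁.trans h₂.symm).eq

theorem liftTerm_sound {X Y : List S.Ob} {f f' : FreeTerm S hyp X Y} (h : FreeRel S hyp f f') :
    liftTerm H o g f = liftTerm H o g f' := by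
  have ap (X Y : List S.Ob) := liftObj_append o X Y
  have R {A B : D} (k : A ⟶ B) : Same k k := Same.refl k
  induction h with
  | comp_left g' h ih => simp only [liftTerm, ih]
  | comp_right f' h ih => simp only [liftTerm, ih]
  | tensor_left g' h ih => simp only [liftTerm, ih]
  | tensor_right f' h ih => simp only [liftTerm, ih]
  | id_comp f => simp [liftTerm]
  | comp_id f => simp [liftTerm]
  | assoc f g h => simp [liftTerm]
  | tensor_id X Y =>
    exact eq_of_same H o g (id_tensorHom_id _ _)
      (same_tensor H o g (same_id H o g rfl) (same_id H o g rfl)) (same_id H o g (ap _ _))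
  | tensor_comp f f' k k' =>
    exact eq_of_same H o g (tensorHom_comp_tensorHom _ _ _ _)
      (same_comp H o g (same_tensor H o g (R _) (R _)) (same_tensor H o g (R _) (R _)))
      (same_tensor H o g (same_comp H o g (R _) (R _)) (same_comp H o g (R _) (R _)))
  | tensor_assoc f₁ f₂ f₃ =>
    exact eq_of_same H o g (associator_naturality _ _ _)
      (same_comp H o g (same_tensor H o g (same_tensor H o g (R _) (R _)) (R _))
        (same_assoc H o g rfl rfl rfl))
      (same_comp H o g (same_assoc H o g rfl rfl rfl)
        (same_tensor H o g (R _) (same_tensor H o g (R _) (R _))))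
  | unit_tensor f =>
    refine eq_of_same H o g (k := (λ_ _).hom ≫ liftTerm H o g f) rfl ?_ ?_
    · refine Same.trans ?_ (Same.of_eq (leftUnitor_naturality _))
      have h := same_comp H o g (same_whiskerLeft H o g (f := f) (R _) (X' := []) rfl)
        (same_leftUnitor H o g rfl)
      have e : liftTerm H o g (.comp (.tensor (.id []) f) (.id _)) =
          liftTerm H o g (.tensor (.id []) f) := by
        rw [liftTerm, liftTerm]; exact Category.comp_id _
      exact (Same.of_eq e.symm).trans h
    · rw [StrictMonoidal.leftUnitor_eq]; exact (Same.eqToHom_comp _ _).symm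
  | tensor_unit f =>
    exact eq_of_same H o g (rightUnitor_naturality _)
      (same_comp H o g (same_whiskerRight H o g (R _) rfl) (same_rightUnitor H o g rfl))
      (same_comp H o g (same_rightUnitor H o g rfl) (R _))
  | braid_natural f f' =>
    exact eq_of_same H o g (BraidedCategory.braiding_naturality _ _)
      (same_comp H o g (same_tensor H o g (R _) (R _)) (same_braid H o g rfl rfl))
      (same_comp H o g (same_braid H o g rfl rfl) (same_tensor H o g (R _) (R _)))
  | symmetry X Y =>
    exact eq_of_same H o g (SymmetricCategory.symmetry _ _)
      (same_comp H o g (same_braid H o g rfl rfl) (same_braid H o g rfl rfl))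
      (same_id H o g (ap _ _))
  | hexagon_forward X Y Z =>
    exact eq_of_same H o g (BraidedCategory.hexagon_forward _ _ _)
      (same_comp H o g (same_assoc H o g rfl rfl rfl) (same_comp H o g
        (same_braid H o g rfl (ap _ _)) (same_assoc H o g rfl rfl rfl)))
      (same_comp H o g (same_whiskerRight H o g (same_braid H o g rfl rfl) rfl)
        (same_comp H o g (same_assoc H o g rfl rfl rfl)
          (same_whiskerLeft H o g (same_braid H o g rfl rfl) rfl)))
  | hexagon_reverse X Y Z =>
    exact eq_of_same H o g (BraidedCategory.hexagon_reverse _ _ _)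
      (same_comp H o g (same_assoc_inv H o g rfl rfl rfl) (same_comp H o g
        (same_braid H o g (ap _ _) rfl) (same_assoc_inv H o g rfl rfl rfl)))
      (same_comp H o g (same_whiskerLeft H o g (same_braid H o g rfl rfl) rfl)
        (same_comp H o g (same_assoc_inv H o g rfl rfl rfl)
          (same_whiskerRight H o g (same_braid H o g rfl rfl) rfl)))
  | copy_comm X =>
    exact eq_of_same H o g (IsCommComonObj.comul_comm _)
      (same_comp H o g (same_copy H o g rfl) (same_braid H o g rfl rfl)) (same_copy H o g rfl)
  | copy_assoc X =>
    exact eq_of_same H o g (ComonObj.comul_assoc _)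
      (same_comp H o g (same_copy H o g rfl) (same_whiskerLeft H o g (same_copy H o g rfl) rfl))
      (same_comp H o g (same_copy H o g rfl) (same_comp H o g
        (same_whiskerRight H o g (same_copy H o g rfl) rfl) (same_assoc H o g rfl rfl rfl)))
  | delete_copy X =>
    exact eq_of_same H o g (ComonObj.counit_comul _)
      (same_comp H o g (same_copy H o g rfl)
        (same_whiskerRight H o g (same_delete H o g rfl) rfl))
      (same_leftUnitor_inv H o g rfl)
  | copy_delete X =>
    exact eq_of_same H o g (ComonObj.comul_counit _)
      (same_comp H o g (same_copy H o g rfl)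
        (same_whiskerLeft H o g (same_delete H o g rfl) rfl))
      (same_rightUnitor_inv H o g rfl)
  | copy_tensor X Y =>
    exact eq_of_same H o g (CopyDiscardCategory.copy_tensor _ _)
      (same_copy H o g (ap _ _))
      (same_comp H o g (same_tensor H o g (same_copy H o g rfl) (same_copy H o g rfl))
        (same_middle H o g rfl rfl rfl rfl))
  | delete_tensor X Y =>
    refine eq_of_same H o g (CopyDiscardCategory.discard_tensor _ _)
      (same_delete H o g (ap _ _)) (Same.symm ?_)
    rw [StrictMonoidal.leftUnitor_eq]
    exact (Same.comp_eqToHom _ _).trans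
      (same_tensor H o g (same_delete H o g rfl) (same_delete H o g rfl)).symm
  | copy_nil =>
    exact eq_of_same H o g CopyDiscardCategory.copy_unit (same_copy H o g rfl)
      (same_leftUnitor_inv H o g rfl)
  | delete_nil =>
    exact eq_of_same H o g CopyDiscardCategory.discard_unit (same_delete H o g rfl)
      (same_id H o g rfl)
  | compare_comm h X =>
    let := H h
    exact eq_of_same H o g (IsCommMonObj.mul_comm _)
      (same_comp H o g (same_braid H o g rfl rfl) (same_compare H o g h rfl))
      (same_compare H o g h rfl)
  | compare_assoc h X =>
    let := H h
    exact eq_of_same H o g (MonObj.mul_assoc _)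
      (same_comp H o g (same_whiskerRight H o g (same_compare H o g h rfl) rfl)
        (same_compare H o g h rfl))
      (same_comp H o g (same_assoc H o g rfl rfl rfl) (same_comp H o g
        (same_whiskerLeft H o g (same_compare H o g h rfl) rfl) (same_compare H o g h rfl)))
  | omni_compare h X =>
    let := H h
    exact eq_of_same H o g (MonObj.one_mul _)
      (same_comp H o g (same_whiskerRight H o g (same_omni H o g h rfl) rfl)
        (same_compare H o g h rfl))
      (same_leftUnitor H o g rfl)
  | compare_omni h X =>
    let := H h
    exact eq_of_same H o g (MonObj.mul_one _)
      (same_comp H o g (same_whiskerLeft H o g (same_omni H o g h rfl) rfl)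
        (same_compare H o g h rfl))
      (same_rightUnitor H o g rfl)
  | compare_tensor h X Y =>
    let := H h
    exact eq_of_same H o g (HypergraphCategory.compare_tensor _ _)
      (same_compare H o g h (ap _ _))
      (same_comp H o g (same_middle H o g rfl rfl rfl rfl)
        (same_tensor H o g (same_compare H o g h rfl) (same_compare H o g h rfl)))
  | omni_tensor h X Y =>
    let := H h
    refine eq_of_same H o g (HypergraphCategory.omni_tensor _ _)
      (same_omni H o g h (ap _ _)) (Same.symm ?_)
    rw [leftUnitor_inv_eq]
    exact (Same.eqToHom_comp _ _).trans
      (same_tensor H o g (same_omni H o g h rfl) (same_omni H o g h rfl)).symm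
  | compare_nil h =>
    let := H h
    exact eq_of_same H o g HypergraphCategory.compare_unit (same_compare H o g h rfl)
      (same_leftUnitor H o g rfl)
  | omni_nil h =>
    let := H h
    exact eq_of_same H o g HypergraphCategory.omni_unit (same_omni H o g h rfl)
      (same_id H o g rfl)
  | special h X =>
    let := H h
    exact eq_of_same H o g (HypergraphCategory.special _)
      (same_comp H o g (same_copy H o g rfl) (same_compare H o g h rfl)) (same_id H o g rfl)
  | frobenius_left h X =>
    let := H h
    exact eq_of_same H o g (HypergraphCategory.frobenius_left _)
      (same_comp H o g (same_whiskerRight H o g (same_copy H o g rfl) rfl)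
        (same_comp H o g (same_assoc H o g rfl rfl rfl)
          (same_whiskerLeft H o g (same_compare H o g h rfl) rfl)))
      (same_comp H o g (same_compare H o g h rfl) (same_copy H o g rfl))
  | frobenius_right h X =>
    let := H h
    exact eq_of_same H o g (HypergraphCategory.frobenius_right _)
      (same_comp H o g (same_whiskerLeft H o g (same_copy H o g rfl) rfl)
        (same_comp H o g (same_assoc_inv H o g rfl rfl rfl)
          (same_whiskerRight H o g (same_compare H o g h rfl) rfl)))
      (same_comp H o g (same_compare H o g h rfl) (same_copy H o g rfl))

/-- The functor out of a free category determined by its values on the generators. -/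
def liftFunctor : FreeStr S hyp ⥤ D where
  obj X := liftObj o X.of
  map f := Quot.lift (liftTerm H o g) (fun _ _ h => liftTerm_sound H o g h) f
  map_id _ := rfl
  map_comp := by rintro X Y Z ⟨f⟩ ⟨f'⟩; rfl

theorem liftFunctor_isCD : IsCDFunctor (liftFunctor H o g) where
  obj_unit := rfl
  obj_tensor X Y := liftObj_append o X.of Y.of
  map_tensor := by
    rintro X Y X' Y' ⟨f⟩ ⟨f'⟩
    exact same_tensor H o g (Same.refl _) (Same.refl _)
  map_braiding X Y := same_braid H o g rfl rfl
  map_copy X := same_copy H o g rfl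
  map_delete X := same_delete H o g rfl

end Lift

/-- The CD-functor out of a free CD-category determined by its values on generators. -/
def liftCD {S : Signature.{u}} {D : Type u₂} [Category.{v₂} D] [MonoidalCategory D]
    [StrictMonoidal D] [CopyDiscardCategory D] (o : S.Ob → D)
    (g : (s : S.Gen) → (liftObj o (S.src s) ⟶ liftObj o (S.tgt s))) :
    CDFunctor (FreeStr S False) D where
  toFunctor := liftFunctor False.elim o g
  isCD := liftFunctor_isCD _ o g

/-- The hypergraph functor out of a free hypergraph category determined by its values on
generators. -/
def liftHypergraph {S : Signature.{u}} {D : Type u₂} [Category.{v₂} D] [MonoidalCategory D]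
    [StrictMonoidal D] [CopyDiscardCategory D] [H : HypergraphCategory D] (o : S.Ob → D)
    (g : (s : S.Gen) → (liftObj o (S.src s) ⟶ liftObj o (S.tgt s))) :
    HypergraphFunctor (FreeStr S True) D where
  toFunctor := liftFunctor (fun _ => H) o g
  isHypergraph :=
    { liftFunctor_isCD (fun _ => H) o g with
      map_compare := fun _ => same_compare (fun _ => H) o g trivial rfl
      map_omni := fun _ => same_omni (fun _ => H) o g trivial rfl }

/-! ### Matrices and stochastic matrices -/

/-- Objects of the category of matrices: finite sets of finite lists over an alphabet `U`, all of
the same length. -/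
@[ext]
structure Mat (U : Type w) where
  carrier : Finset (List U)
  uniform : ∃ n : ℕ, ∀ x ∈ carrier, x.length = n

namespace Mat

variable {U : Type w}

/-- The elements of the finite set `X`. -/
abbrev El (X : Mat U) : Type w := {x : List U // x ∈ X.carrier}

open scoped Classical in
/-- A morphism `f : X ⟶ Y` is a function `Y × X → ℝ≥0`; `f y x` is `f(y | x)`. -/
noncomputable instance : Category.{w} (Mat U) where
  Hom X Y := Y.El → X.El → ℝ≥0
  id X := fun y x => if y = x then 1 else 0
  comp {_ Y _} f g := fun z x => ∑ y : Y.El, g z y * f y x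
  id_comp f := by funext y x; simp
  comp_id f := by funext y x; simp
  assoc f g h := by
    funext y x
    simp only [Finset.mul_sum, Finset.sum_mul, mul_assoc]
    exact Finset.sum_comm

theorem hom_ext {X Y : Mat U} {f g : X ⟶ Y} (h : ∀ y x, f y x = g y x) : f = g := by
  funext y x; exact h y x

theorem comp_apply {X Y Z : Mat U} (f : X ⟶ Y) (g : Y ⟶ Z) (z : Z.El) (x : X.El) :
    (f ≫ g) z x = ∑ y : Y.El, g z y * f y x := rfl

open scoped Classical in
theorem id_apply (X : Mat U) (y x : X.El) : (𝟙 X : X ⟶ X) y x = if y = x then 1 else 0 := rfl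

open scoped Classical in
/-- Elements of the tensor product are concatenations. -/
noncomputable def tensor (X Y : Mat U) : Mat U where
  carrier := (X.carrier ×ˢ Y.carrier).image fun p => p.1 ++ p.2
  uniform := by
    obtain ⟨n, hn⟩ := X.uniform
    obtain ⟨m, hm⟩ := Y.uniform
    refine ⟨n + m, fun x hx => ?_⟩
    simp only [Finset.mem_image, Finset.mem_product, Prod.exists] at hx
    obtain ⟨a, b, ⟨ha, hb⟩, rfl⟩ := hx
    rw [List.length_append, hn a ha, hm b hb]

theorem mem_tensor {X Y : Mat U} {z : List U} :
    z ∈ (tensor X Y).carrier ↔ ∃ x ∈ X.carrier, ∃ y ∈ Y.carrier, x ++ y = z := by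
  simp only [tensor, Finset.mem_image, Finset.mem_product, Prod.exists]
  constructor
  · rintro ⟨a, b, ⟨ha, hb⟩, h⟩; exact ⟨a, ha, b, hb, h⟩
  · rintro ⟨a, ha, b, hb, h⟩; exact ⟨a, b, ⟨ha, hb⟩, h⟩

/-- Pairing of elements, that is, concatenation. -/
def pair {X Y : Mat U} (x : X.El) (y : Y.El) : (tensor X Y).El :=
  ⟨x.1 ++ y.1, mem_tensor.2 ⟨x.1, x.2, y.1, y.2, rfl⟩⟩

theorem pair_bijective (X Y : Mat U) :
    Function.Bijective fun p : X.El × Y.El => pair p.1 p.2 := by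
  constructor
  · rintro ⟨x, y⟩ ⟨x', y'⟩ h
    have h' : x.1 ++ y.1 = x'.1 ++ y'.1 := congrArg Subtype.val h
    obtain ⟨n, hn⟩ := X.uniform
    obtain ⟨h₁, h₂⟩ := List.append_inj h' ((hn _ x.2).trans (hn _ x'.2).symm)
    exact Prod.ext (Subtype.ext h₁) (Subtype.ext h₂)
  · rintro ⟨z, hz⟩
    obtain ⟨x, hx, y, hy, h⟩ := mem_tensor.1 hz
    exact ⟨(⟨x, hx⟩, ⟨y, hy⟩), Subtype.ext h⟩

/-- The elements of the tensor product are the pairs. -/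
noncomputable def pairEquiv (X Y : Mat U) : X.El × Y.El ≃ (tensor X Y).El :=
  Equiv.ofBijective _ (pair_bijective X Y)

/-- First component. -/
noncomputable def fst {X Y : Mat U} (z : (tensor X Y).El) : X.El := ((pairEquiv X Y).symm z).1

/-- Second component. -/
noncomputable def snd {X Y : Mat U} (z : (tensor X Y).El) : Y.El := ((pairEquiv X Y).symm z).2

@[simp] theorem fst_pair {X Y : Mat U} (x : X.El) (y : Y.El) : fst (pair x y) = x :=
  congrArg Prod.fst ((pairEquiv X Y).symm_apply_apply (x, y))

@[simp] theorem snd_pair {X Y : Mat U} (x : X.El) (y : Y.El) : snd (pair x y) = y :=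
  congrArg Prod.snd ((pairEquiv X Y).symm_apply_apply (x, y))

@[simp] theorem pair_fst_snd {X Y : Mat U} (z : (tensor X Y).El) : pair (fst z) (snd z) = z :=
  (pairEquiv X Y).apply_symm_apply z

theorem exists_pair {X Y : Mat U} (z : (tensor X Y).El) : ∃ x y, z = pair x y :=
  ⟨fst z, snd z, (pair_fst_snd z).symm⟩

theorem pair_inj {X Y : Mat U} {x x' : X.El} {y y' : Y.El} :
    pair x y = pair x' y' ↔ x = x' ∧ y = y' := by
  constructor
  · intro h
    have h := (pair_bijective X Y).1 (a₁ := (x, y)) (a₂ := (x', y')) h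
    exact ⟨congrArg Prod.fst h, congrArg Prod.snd h⟩
  · rintro ⟨rfl, rfl⟩; rfl

theorem sum_pair {X Y : Mat U} {M : Type*} [AddCommMonoid M] (F : (tensor X Y).El → M) :
    ∑ z, F z = ∑ x, ∑ y, F (pair x y) := by
  rw [← (pairEquiv X Y).sum_comp, Fintype.sum_prod_type]; rfl

/-- The one-element set consisting of the empty list. -/
def unit : Mat U where
  carrier := {[]}
  uniform := ⟨0, by simp⟩

/-- The element of the unit. -/
def star : (unit : Mat U).El := ⟨[], by simp [unit]⟩

theorem eq_star (x : (unit : Mat U).El) : x = star :=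
  Subtype.ext (Finset.mem_singleton.1 x.2)

instance : Unique (unit : Mat U).El := ⟨⟨star⟩, eq_star⟩

theorem tensor_assoc (X Y Z : Mat U) : tensor (tensor X Y) Z = tensor X (tensor Y Z) := by
  ext z
  simp only [mem_tensor]
  constructor
  · rintro ⟨_, ⟨x, hx, y, hy, rfl⟩, z, hz, rfl⟩
    exact ⟨x, hx, _, ⟨y, hy, z, hz, rfl⟩, (List.append_assoc _ _ _).symm⟩
  · rintro ⟨x, hx, _, ⟨y, hy, z, hz, rfl⟩, rfl⟩
    exact ⟨_, ⟨x, hx, y, hy, rfl⟩, z, hz, List.append_assoc _ _ _⟩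

theorem unit_tensor (X : Mat U) : tensor unit X = X := by
  ext z; simp [mem_tensor, unit]

theorem tensor_unit (X : Mat U) : tensor X unit = X := by
  ext z; simp [mem_tensor, unit]

/-! Matrices of functions, and their transposes. -/

open scoped Classical in
/-- The matrix of a function. -/
noncomputable def fn {X Y : Mat U} (u : X.El → Y.El) : X ⟶ Y := fun y x => if y = u x then 1 else 0

/-- Transposed matrix. -/
def transpose {X Y : Mat U} (f : X ⟶ Y) : Y ⟶ X := fun x y => f y x

open scoped Classical in
theorem fn_apply {X Y : Mat U} (u : X.El → Y.El) (y : Y.El) (x : X.El) :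
    fn u y x = if y = u x then 1 else 0 := rfl

theorem fn_id (X : Mat U) : fn (id : X.El → X.El) = 𝟙 X := rfl

theorem fn_comp_apply {X Y Z : Mat U} (u : X.El → Y.El) (f : Y ⟶ Z) (z : Z.El) (x : X.El) :
    (fn u ≫ f) z x = f z (u x) := by
  simp [comp_apply, fn_apply]

theorem fn_comp {X Y Z : Mat U} (u : X.El → Y.El) (v : Y.El → Z.El) : fn u ≫ fn v = fn (v ∘ u) :=
  hom_ext fun z x => by rw [fn_comp_apply]; rfl

theorem comp_fn_apply {X Y Z : Mat U} (f : X ⟶ Y) (e : Y.El ≃ Z.El) (z : Z.El) (x : X.El) :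
    (f ≫ fn e) z x = f (e.symm z) x := by
  rw [comp_apply, Finset.sum_eq_single (e.symm z)]
  · simp [fn_apply]
  · intro y _ hy
    rw [fn_apply, if_neg (fun h => hy (e.symm_apply_eq.2 h).symm), zero_mul]
  · intro h; exact absurd (Finset.mem_univ _) h

theorem transpose_comp {X Y Z : Mat U} (f : X ⟶ Y) (g : Y ⟶ Z) :
    transpose (f ≫ g) = transpose g ≫ transpose f :=
  hom_ext fun x z => by simp only [transpose, comp_apply, mul_comm]

theorem transpose_fn_equiv {X Y : Mat U} (e : X.El ≃ Y.El) : transpose (fn e) = fn e.symm := by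
  refine hom_ext fun x y => ?_
  rw [transpose, fn_apply, fn_apply]
  classical exact if_congr (e.eq_symm_apply.trans eq_comm).symm rfl rfl

/-- Isomorphism induced by a bijection. -/
noncomputable def equivIso {X Y : Mat U} (e : X.El ≃ Y.El) : X ≅ Y where
  hom := fn e
  inv := fn e.symm
  hom_inv_id := by rw [fn_comp, ← fn_id]; congr 1; funext x; simp
  inv_hom_id := by rw [fn_comp, ← fn_id]; congr 1; funext x; simp

/-- Elements of equal objects. -/
def castEquiv {X Y : Mat U} (h : X = Y) : X.El ≃ Y.El :=
  Equiv.subtypeEquivRight fun x => by rw [h]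

@[simp] theorem castEquiv_val {X Y : Mat U} (h : X = Y) (x : X.El) : (castEquiv h x).1 = x.1 := rfl

@[simp] theorem castEquiv_symm_val {X Y : Mat U} (h : X = Y) (y : Y.El) :
    ((castEquiv h).symm y).1 = y.1 := rfl

theorem eqToHom_eq {X Y : Mat U} (h : X = Y) : eqToHom h = fn (castEquiv h) := by
  subst h; rfl

noncomputable instance : MonoidalCategoryStruct (Mat U) where
  tensorObj := tensor
  tensorHom f g := fun y x => f (fst y) (fst x) * g (snd y) (snd x)
  whiskerLeft X _ _ g := fun y x => (𝟙 X : X ⟶ X) (fst y) (fst x) * g (snd y) (snd x)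
  whiskerRight f Y := fun y x => f (fst y) (fst x) * (𝟙 Y : Y ⟶ Y) (snd y) (snd x)
  tensorUnit := unit
  associator X Y Z := equivIso (castEquiv (tensor_assoc X Y Z))
  leftUnitor X := equivIso (castEquiv (unit_tensor X))
  rightUnitor X := equivIso (castEquiv (tensor_unit X))

theorem tensorHom_apply {X Y X' Y' : Mat U} (f : X ⟶ Y) (g : X' ⟶ Y') (y : Y.El) (y' : Y'.El)
    (x : X.El) (x' : X'.El) :
    (f ⊗ₘ g) (pair y y' : (tensor Y Y').El) (pair x x' : (tensor X X').El) = f y x * g y' x' := by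
  change f (fst (pair y y')) (fst (pair x x')) * g (snd (pair y y')) (snd (pair x x')) = _
  simp

theorem tensor_hom_ext {X Y X' Y' : Mat U} {f g : (X ⊗ X') ⟶ (Y ⊗ Y')}
    (h : ∀ y y' x x', f (pair y y' : (tensor Y Y').El) (pair x x' : (tensor X X').El) =
      g (pair y y' : (tensor Y Y').El) (pair x x' : (tensor X X').El)) : f = g := by
  refine hom_ext fun y x => ?_
  obtain ⟨y, y', rfl⟩ := exists_pair (X := Y) (Y := Y') y
  obtain ⟨x, x', rfl⟩ := exists_pair (X := X) (Y := X') x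
  exact h y y' x x'

theorem tensor_fn {X Y X' Y' : Mat U} (u : X.El → Y.El) (u' : X'.El → Y'.El) :
    (fn u ⊗ₘ fn u') = fn (X := X ⊗ X') (Y := Y ⊗ Y')
      (fun z => pair (u (fst (X := X) (Y := X') z)) (u' (snd (X := X) (Y := X') z))) := by
  refine tensor_hom_ext fun y y' x x' => ?_
  rw [tensorHom_apply, fn_apply, fn_apply]
  refine Eq.trans ?_ (fn_apply _ _ _).symm
  rw [fst_pair, snd_pair, ite_zero_mul_ite_zero, one_mul]
  classical exact if_congr pair_inj.symm rfl rfl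

theorem id_tensor_id (X Y : Mat U) : (𝟙 X ⊗ₘ 𝟙 Y) = 𝟙 (X ⊗ Y) := by
  rw [← fn_id, ← fn_id, tensor_fn, ← fn_id]
  congr 1; funext z; exact pair_fst_snd (X := X) (Y := Y) z

theorem eqToHom_tensor {X X' Y Y' : Mat U} (h : X = X') (k : Y = Y') :
    (eqToHom h ⊗ₘ eqToHom k) = eqToHom (congrArg₂ tensorObj h k) := by
  subst h k; exact id_tensor_id _ _

theorem associator_eq (X Y Z : Mat U) : (α_ X Y Z).hom =
    eqToHom (tensor_assoc X Y Z : (X ⊗ Y) ⊗ Z = X ⊗ (Y ⊗ Z)) :=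
  (eqToHom_eq (tensor_assoc X Y Z)).symm

theorem leftUnitor_eq (X : Mat U) : (λ_ X).hom = eqToHom (unit_tensor X : 𝟙_ _ ⊗ X = X) :=
  (eqToHom_eq (unit_tensor X)).symm

theorem rightUnitor_eq (X : Mat U) : (ρ_ X).hom = eqToHom (tensor_unit X : X ⊗ 𝟙_ _ = X) :=
  (eqToHom_eq (tensor_unit X)).symm

theorem fn_castEquiv_comp {X Y Z : Mat U} (h : X = Y) (f : Y ⟶ Z) (z : Z.El) (x : X.El) :
    ((fn (castEquiv h) : X ⟶ Y) ≫ f) z x = f z ⟨x.1, h ▸ x.2⟩ := fn_comp_apply _ f z x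

theorem comp_fn_castEquiv {X Y Z : Mat U} (f : X ⟶ Y) (h : Y = Z) (z : Z.El) (x : X.El) :
    (f ≫ (fn (castEquiv h) : Y ⟶ Z)) z x = f ⟨z.1, h ▸ z.2⟩ x := comp_fn_apply f (castEquiv h) z x

noncomputable instance : MonoidalCategory (Mat U) :=
  MonoidalCategory.ofTensorHom
    (id_tensorHom_id := id_tensor_id)
    (id_tensorHom := fun _ _ _ _ => rfl)
    (tensorHom_id := fun _ _ => rfl)
    (tensorHom_comp_tensorHom := fun {X₁ Y₁ Z₁ X₂ Y₂ Z₂} f₁ f₂ g₁ g₂ => by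
      refine tensor_hom_ext fun y y' x x' => ?_
      rw [tensorHom_apply, comp_apply, comp_apply, comp_apply, Finset.sum_mul_sum]
      refine (sum_pair (X := Y₁) (Y := Y₂) _).trans ?_
      refine Finset.sum_congr rfl fun a _ => Finset.sum_congr rfl fun b _ => ?_
      rw [tensorHom_apply, tensorHom_apply]
      ring)
    (associator_naturality := fun {X₁ X₂ X₃ Y₁ Y₂ Y₃} f₁ f₂ f₃ => by
      refine hom_ext fun z x => ?_
      obtain ⟨y₁, y', rfl⟩ := exists_pair (X := Y₁) (Y := tensor Y₂ Y₃) z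
      obtain ⟨y₂, y₃, rfl⟩ := exists_pair y'
      obtain ⟨x', x₃, rfl⟩ := exists_pair (X := tensor X₁ X₂) (Y := X₃) x
      obtain ⟨x₁, x₂, rfl⟩ := exists_pair x'
      refine (comp_fn_castEquiv _ (tensor_assoc Y₁ Y₂ Y₃) _ _).trans
        (Eq.trans ?_ (fn_castEquiv_comp (tensor_assoc X₁ X₂ X₃) _ _ _).symm)
      have e₁ : (⟨(pair y₁ (pair y₂ y₃)).1, by
          rw [tensor_assoc]; exact (pair y₁ (pair y₂ y₃)).2⟩ : (tensor (tensor Y₁ Y₂) Y₃).El) =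
          pair (pair y₁ y₂) y₃ := Subtype.ext (List.append_assoc _ _ _).symm
      have e₂ : (⟨(pair (pair x₁ x₂) x₃).1, by
          rw [← tensor_assoc]; exact (pair (pair x₁ x₂) x₃).2⟩ : (tensor X₁ (tensor X₂ X₃)).El) =
          pair x₁ (pair x₂ x₃) := Subtype.ext (List.append_assoc _ _ _)
      refine (congrArg (fun t => ((f₁ ⊗ₘ f₂) ⊗ₘ f₃) t _) e₁).trans
        (Eq.trans ?_ (congrArg (fun t => (f₁ ⊗ₘ (f₂ ⊗ₘ f₃)) _ t) e₂).symm)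
      refine (tensorHom_apply (f₁ ⊗ₘ f₂) f₃ _ _ _ _).trans
        (Eq.trans ?_ (tensorHom_apply f₁ (f₂ ⊗ₘ f₃) _ _ _ _).symm)
      rw [tensorHom_apply, tensorHom_apply, mul_assoc])
    (leftUnitor_naturality := fun {X Y} f => by
      refine hom_ext fun y x => ?_
      obtain ⟨s, x, rfl⟩ := exists_pair (X := unit) (Y := X) x
      refine (comp_fn_castEquiv _ (unit_tensor Y) _ _).trans
        (Eq.trans ?_ (fn_castEquiv_comp (unit_tensor X) _ _ _).symm)
      obtain rfl := eq_star s
      have e₁ : (⟨y.1, by rw [unit_tensor]; exact y.2⟩ : (tensor unit Y).El) = pair star y := rfl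
      refine (congrArg (fun t => (𝟙 (𝟙_ (Mat U)) ⊗ₘ f) t _) e₁).trans ?_
      refine (tensorHom_apply (𝟙 (𝟙_ (Mat U))) f _ _ _ _).trans ?_
      rw [id_apply, if_pos rfl, one_mul]; rfl)
    (rightUnitor_naturality := fun {X Y} f => by
      refine hom_ext fun y x => ?_
      obtain ⟨x, s, rfl⟩ := exists_pair (X := X) (Y := unit) x
      refine (comp_fn_castEquiv _ (tensor_unit Y) _ _).trans
        (Eq.trans ?_ (fn_castEquiv_comp (tensor_unit X) _ _ _).symm)
      obtain rfl := eq_star s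
      have e₁ : (⟨y.1, by rw [tensor_unit]; exact y.2⟩ : (tensor Y unit).El) = pair y star :=
        Subtype.ext (List.append_nil _).symm
      have e₂ : (⟨(pair x star).1, by
          change x.1 ++ [] ∈ X.carrier; rw [List.append_nil]; exact x.2⟩ : X.El) = x :=
        Subtype.ext (List.append_nil _)
      refine (congrArg (fun t => (f ⊗ₘ 𝟙 (𝟙_ (Mat U))) t _) e₁).trans
        (Eq.trans ?_ (congrArg (fun t => f _ t) e₂).symm)
      refine (tensorHom_apply f (𝟙 (𝟙_ (Mat U))) _ _ _ _).trans ?_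
      rw [id_apply, if_pos rfl, mul_one])
    (pentagon := fun W X Y Z => by
      rw [associator_eq, associator_eq, associator_eq, associator_eq, associator_eq,
        ← eqToHom_refl _ rfl, ← eqToHom_refl _ rfl, eqToHom_tensor, eqToHom_tensor]
      simp)
    (triangle := fun X Y => by
      rw [associator_eq, leftUnitor_eq, rightUnitor_eq,
        ← eqToHom_refl _ rfl, ← eqToHom_refl _ rfl, eqToHom_tensor, eqToHom_tensor]
      simp)

instance : StrictMonoidal (Mat U) where
  tensor_assoc := tensor_assoc
  unit_tensor := unit_tensor
  tensor_unit := tensor_unit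
  associator_eq := associator_eq
  leftUnitor_eq := leftUnitor_eq
  rightUnitor_eq := rightUnitor_eq

/-- Exchange of the components of a pair. -/
noncomputable def swapEquiv (X Y : Mat U) : (tensor X Y).El ≃ (tensor Y X).El :=
  (pairEquiv X Y).symm.trans ((Equiv.prodComm _ _).trans (pairEquiv Y X))

@[simp] theorem swapEquiv_pair {X Y : Mat U} (x : X.El) (y : Y.El) :
    swapEquiv X Y (pair x y) = pair y x := by
  change pair (snd (pair x y)) (fst (pair x y)) = pair y x
  simp

@[simp] theorem swapEquiv_symm_pair {X Y : Mat U} (x : X.El) (y : Y.El) :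
    (swapEquiv X Y).symm (pair y x) = pair x y := by
  rw [Equiv.symm_apply_eq, swapEquiv_pair]

/-- Matrices of functions on a tensor product, through pairs. -/
theorem fn_congr {X Y : Mat U} {u v : X.El → Y.El} (h : ∀ x, (u x).1 = (v x).1) :
    fn u = fn v := by
  congr 1; funext x; exact Subtype.ext (h x)

theorem braiding_naturality {X Y X' Y' : Mat U} (f : X ⟶ Y) (g : X' ⟶ Y') :
    (f ⊗ₘ g) ≫ (fn (swapEquiv Y Y') : Y ⊗ Y' ⟶ Y' ⊗ Y) =
      (fn (swapEquiv X X') : X ⊗ X' ⟶ X' ⊗ X) ≫ (g ⊗ₘ f) := by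
  refine tensor_hom_ext fun y' y x x' => ?_
  refine (comp_fn_apply (f ⊗ₘ g) (swapEquiv Y Y') _ _).trans
    (Eq.trans ?_ (fn_comp_apply _ (g ⊗ₘ f) _ _).symm)
  rw [swapEquiv_symm_pair, swapEquiv_pair]
  refine (tensorHom_apply f g _ _ _ _).trans (Eq.trans ?_ (tensorHom_apply g f _ _ _ _).symm)
  exact mul_comm _ _

theorem whiskerLeft_fn (Z : Mat U) {X Y : Mat U} (u : X.El → Y.El) :
    Z ◁ fn u = fn (X := Z ⊗ X) (Y := Z ⊗ Y)
      (fun z => pair (fst (X := Z) (Y := X) z) (u (snd (X := Z) (Y := X) z))) := by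
  rw [← id_tensorHom, ← fn_id, tensor_fn]; rfl

theorem whiskerRight_fn (Z : Mat U) {X Y : Mat U} (u : X.El → Y.El) :
    fn u ▷ Z = fn (X := X ⊗ Z) (Y := Y ⊗ Z)
      (fun z => pair (u (fst (X := X) (Y := Z) z)) (snd (X := X) (Y := Z) z)) := by
  rw [← tensorHom_id, ← fn_id, tensor_fn]; rfl

theorem associator_hom_fn (X Y Z : Mat U) :
    (α_ X Y Z).hom = fn (castEquiv (tensor_assoc X Y Z)) := rfl

theorem associator_inv_fn (X Y Z : Mat U) :
    (α_ X Y Z).inv = fn (castEquiv (tensor_assoc X Y Z)).symm := rfl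

@[simp] theorem castEquiv_assoc {X Y Z : Mat U} (x : X.El) (y : Y.El) (z : Z.El) :
    castEquiv (tensor_assoc X Y Z) (pair (pair x y) z) = pair x (pair y z) :=
  Subtype.ext (List.append_assoc _ _ _)

@[simp] theorem castEquiv_assoc_symm {X Y Z : Mat U} (x : X.El) (y : Y.El) (z : Z.El) :
    (castEquiv (tensor_assoc X Y Z)).symm (pair x (pair y z)) = pair (pair x y) z :=
  Subtype.ext (List.append_assoc _ _ _).symm

noncomputable instance : SymmetricCategory (Mat U) where
  braiding X Y := equivIso (swapEquiv X Y)
  braiding_naturality_right X Y Z f := by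
    rw [← id_tensorHom, ← tensorHom_id]; exact braiding_naturality _ _
  braiding_naturality_left f Z := by
    rw [← id_tensorHom, ← tensorHom_id]; exact braiding_naturality _ _
  hexagon_forward X Y Z := by
    simp only [associator_hom_fn, equivIso, whiskerLeft_fn, whiskerRight_fn]
    refine (congrArg _ (fn_comp _ _)).trans ((fn_comp _ _).trans (Eq.trans ?_
      ((congrArg _ (fn_comp _ _)).trans (fn_comp _ _)).symm))
    congr 1; funext t
    obtain ⟨t, z, rfl⟩ := exists_pair (X := tensor X Y) (Y := Z) t
    obtain ⟨x, y, rfl⟩ := exists_pair t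
    simp [tensorObj]
  hexagon_reverse X Y Z := by
    simp only [associator_inv_fn, equivIso, whiskerLeft_fn, whiskerRight_fn]
    refine (congrArg _ (fn_comp _ _)).trans ((fn_comp _ _).trans (Eq.trans ?_
      ((congrArg _ (fn_comp _ _)).trans (fn_comp _ _)).symm))
    congr 1; funext t
    obtain ⟨x, t, rfl⟩ := exists_pair (X := X) (Y := tensor Y Z) t
    obtain ⟨y, z, rfl⟩ := exists_pair t
    simp [tensorObj]
  symmetry X Y := by
    refine (fn_comp _ _).trans ((?_ : _ = fn id).trans (fn_id _))
    congr 1; funext t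
    obtain ⟨x, y, rfl⟩ := exists_pair (X := X) (Y := Y) t
    exact (congrArg (swapEquiv Y X) (swapEquiv_pair x y)).trans (swapEquiv_pair y x)

/-- `copy (y, z | x)` is `1` if `x = y = z` and `0` otherwise; `delete ( | x)` is `1`. -/
noncomputable instance (X : Mat U) : ComonObj X where
  comul := fn (Y := X ⊗ X) (fun x => pair x x)
  counit := fn (Y := 𝟙_ _) (fun _ => star)
  counit_comul := by
    rw [whiskerRight_fn]
    refine (fn_comp _ _).trans (fn_congr fun x => ?_)
    rw [Function.comp_apply, snd_pair]; rfl
  comul_counit := by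
    rw [whiskerLeft_fn]
    refine (fn_comp _ _).trans (fn_congr fun x => ?_)
    rw [Function.comp_apply, fst_pair]; exact List.append_nil _
  comul_assoc := by
    rw [whiskerLeft_fn, whiskerRight_fn, associator_hom_fn]
    refine (fn_comp _ _).trans (Eq.trans ?_ ((congrArg _ (fn_comp _ _)).trans (fn_comp _ _)).symm)
    congr 1; funext x
    simp [tensorObj]

theorem copy_eq (X : Mat U) : Δ[X] = fn (Y := X ⊗ X) (fun x => pair x x) := rfl

theorem delete_eq (X : Mat U) : ε[X] = fn (Y := 𝟙_ _) (fun _ => star) := rfl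

instance (X : Mat U) : IsCommComonObj X where
  comul_comm := by
    refine (fn_comp _ _).trans ?_
    rw [copy_eq]
    congr 1; funext x
    exact swapEquiv_pair x x

theorem middle_fn (X Y Z W : Mat U) : ∃ u : ((X ⊗ Y) ⊗ (Z ⊗ W)).El → ((X ⊗ Z) ⊗ (Y ⊗ W)).El,
    tensorμ X Y Z W = fn u ∧ ∀ (x : X.El) (y : Y.El) (z : Z.El) (w : W.El),
      u (pair (X := X ⊗ Y) (Y := Z ⊗ W) (pair x y) (pair z w)) =
        pair (X := X ⊗ Z) (Y := Y ⊗ W) (pair x z) (pair y w) := by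
  apply Exists.intro
  apply And.intro
  · unfold tensorμ
    rw [associator_hom_fn, associator_inv_fn, whiskerLeft_fn, associator_hom_fn, whiskerLeft_fn]
    change _ ≫ _ ≫ (X ◁ fn (X := Y ⊗ Z) (Y := Z ⊗ Y) (swapEquiv Y Z) ▷ W) ≫ _ = _
    rw [whiskerRight_fn, whiskerLeft_fn]
    rw [associator_inv_fn, fn_comp, fn_comp, fn_comp, fn_comp]
  · intro x y z w
    simp [tensorObj]

noncomputable instance : CopyDiscardCategory (Mat U) where
  copy_tensor X Y := by
    obtain ⟨u, hu, hu'⟩ := middle_fn X X Y Y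
    rw [hu, copy_eq, copy_eq, copy_eq, tensor_fn, fn_comp]
    congr 1; funext t
    obtain ⟨x, y, rfl⟩ := exists_pair (X := X) (Y := Y) t
    simp only [Function.comp_apply, fst_pair, snd_pair, hu']
  discard_tensor X Y := by
    rw [delete_eq, delete_eq, delete_eq, tensor_fn]
    refine Eq.trans ?_ (fn_comp _ _).symm
    exact fn_congr fun x => rfl
  copy_unit := fn_congr fun x => by obtain rfl := eq_star x; rfl
  discard_unit := by
    rw [delete_eq, ← fn_id]; congr 1; funext x; exact (eq_star x).symm

theorem transpose_tensor {X Y X' Y' : Mat U} (f : X ⟶ Y) (g : X' ⟶ Y') :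
    transpose (f ⊗ₘ g) = (transpose f ⊗ₘ transpose g) := rfl

theorem transpose_id (X : Mat U) : transpose (𝟙 X) = 𝟙 X :=
  transpose_fn_equiv (Equiv.refl X.El)

theorem transpose_whiskerLeft (Z : Mat U) {X Y : Mat U} (f : X ⟶ Y) :
    transpose (Z ◁ f) = Z ◁ transpose f := by
  rw [← id_tensorHom, transpose_tensor, transpose_id, id_tensorHom]

theorem transpose_whiskerRight (Z : Mat U) {X Y : Mat U} (f : X ⟶ Y) :
    transpose (f ▷ Z) = transpose f ▷ Z := by
  rw [← tensorHom_id, transpose_tensor, transpose_id, tensorHom_id]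

theorem transpose_associator (X Y Z : Mat U) : transpose (α_ X Y Z).hom = (α_ X Y Z).inv :=
  transpose_fn_equiv _

theorem transpose_associator_inv (X Y Z : Mat U) : transpose (α_ X Y Z).inv = (α_ X Y Z).hom :=
  transpose_fn_equiv (castEquiv (tensor_assoc X Y Z)).symm

theorem transpose_braiding (X Y : Mat U) : transpose (β_ X Y).hom = (β_ Y X).hom :=
  (transpose_fn_equiv _).trans (Iso.inv_ext' (SymmetricCategory.symmetry X Y)).symm

theorem transpose_middle (X Y Z W : Mat U) :
    transpose (tensorμ X Y Z W) = tensorμ X Z Y W := by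
  simp only [tensorμ, transpose_comp, transpose_whiskerLeft, transpose_whiskerRight,
    transpose_associator, transpose_associator_inv, transpose_braiding, Category.assoc]

/-- `compare (z | x, y)` is `1` if `x = y = z` and `0` otherwise; `omni (x | )` is `1`. -/
noncomputable instance (X : Mat U) : MonObj X where
  mul := transpose Δ[X]
  one := transpose ε[X]
  one_mul := by
    rw [← transpose_whiskerRight, ← transpose_comp, ComonObj.counit_comul]
    exact transpose_fn_equiv (castEquiv (unit_tensor X)).symm
  mul_one := by
    rw [← transpose_whiskerLeft, ← transpose_comp, ComonObj.comul_counit]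
    exact transpose_fn_equiv (castEquiv (tensor_unit X)).symm
  mul_assoc := by
    have h := congrArg transpose (ComonObj.comul_assoc_flip X)
    rw [transpose_comp, transpose_comp, transpose_comp, transpose_whiskerLeft,
      transpose_whiskerRight, transpose_associator_inv, Category.assoc] at h
    exact h

theorem compare_eq (X : Mat U) : μ[X] = transpose Δ[X] := rfl

theorem omni_eq (X : Mat U) : η[X] = transpose ε[X] := rfl

instance (X : Mat U) : IsCommMonObj X where
  mul_comm := by
    rw [compare_eq, ← transpose_braiding, ← transpose_comp, IsCommComonObj.comul_comm]

theorem special (X : Mat U) : Δ[X] ≫ μ[X] = 𝟙 X := by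
  refine hom_ext fun y x => ?_
  rw [copy_eq, fn_comp_apply, id_apply]
  change fn (Y := X ⊗ X) (fun x => pair x x) (pair x x) y = _
  rw [fn_apply]
  classical exact if_congr (pair_inj.trans ⟨fun h => h.1.symm, fun h => ⟨h.symm, h.symm⟩⟩) rfl rfl

theorem frobenius_left (X : Mat U) :
    Δ[X] ▷ X ≫ (α_ X X X).hom ≫ X ◁ μ[X] = μ[X] ≫ Δ[X] := by
  refine tensor_hom_ext fun a b c d => ?_
  rw [copy_eq, whiskerRight_fn]
  refine (fn_comp_apply _ _ _ _).trans ((fn_comp_apply _ _ _ _).trans ?_)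
  rw [fst_pair, snd_pair, castEquiv_assoc, ← id_tensorHom]
  refine (tensorHom_apply (𝟙 X) μ[X] _ _ _ _).trans ?_
  rw [id_apply]
  have hm (y : X.El) : μ[X] y (pair c d) = fn (Y := X ⊗ X) (fun x => pair x x) (pair c d) y := rfl
  rw [comp_apply, hm]
  simp only [hm, fn_apply]
  rw [Finset.sum_eq_single c]
  · classical
    rw [ite_zero_mul_ite_zero, ite_zero_mul_ite_zero]
    refine if_congr ?_ rfl rfl
    rw [pair_inj, pair_inj, pair_inj]
    constructor
    · rintro ⟨rfl, rfl, rfl⟩; exact ⟨⟨rfl, rfl⟩, rfl, rfl⟩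
    · rintro ⟨⟨rfl, rfl⟩, _, rfl⟩; exact ⟨rfl, rfl, rfl⟩
  · intro y _ hy
    rw [if_neg (c := pair c d = pair y y) (fun h => hy (pair_inj.1 h).1.symm), mul_zero]
  · intro h; exact absurd (Finset.mem_univ _) h

noncomputable instance : HypergraphCategory (Mat U) where
  compare_tensor X Y := by
    rw [compare_eq, CopyDiscardCategory.copy_tensor, transpose_comp, transpose_middle,
      transpose_tensor]; rfl
  omni_tensor X Y := by
    rw [omni_eq, CopyDiscardCategory.discard_tensor, transpose_comp, transpose_tensor]
    exact congrArg (fun t => t ≫ (transpose ε[X] ⊗ₘ transpose ε[Y]))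
      (transpose_fn_equiv (castEquiv (unit_tensor (𝟙_ (Mat U)))))
  compare_unit := by
    rw [compare_eq, CopyDiscardCategory.copy_unit]
    exact transpose_fn_equiv (castEquiv (unit_tensor (𝟙_ (Mat U)))).symm
  omni_unit := by
    rw [omni_eq, CopyDiscardCategory.discard_unit, transpose_id]
  special := special
  frobenius_left := frobenius_left
  frobenius_right X := by
    have h := congrArg transpose (frobenius_left X)
    rw [transpose_comp, transpose_comp, transpose_comp, transpose_whiskerLeft,
      transpose_whiskerRight, transpose_associator, Category.assoc] at h
    exact h

end Mat

/-- Stochastic matrices: every column sums to `1`. -/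
def stochastic (U : Type w) : MorphismProperty (Mat U) :=
  fun X Y f => ∀ x : X.El, ∑ y : Y.El, f y x = 1

namespace Mat

variable {U : Type w}

theorem stochastic_fn {X Y : Mat U} (u : X.El → Y.El) : stochastic U (fn u) := by
  intro x
  classical
  rw [Finset.sum_eq_single (u x)]
  · rw [fn_apply, if_pos rfl]
  · intro y _ hy; rw [fn_apply, if_neg hy]
  · intro h; exact absurd (Finset.mem_univ _) h

instance : (stochastic U).IsMultiplicative where
  id_mem X := stochastic_fn id
  comp_mem {X Y Z} f g hf hg := by
    intro x
    simp only [comp_apply]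
    rw [Finset.sum_comm]
    simp only [← Finset.sum_mul, hg _, one_mul, hf x]

theorem stochastic_tensor {X Y X' Y' : Mat U} (f : X ⟶ Y) (g : X' ⟶ Y') (hf : stochastic U f)
    (hg : stochastic U g) : stochastic U (f ⊗ₘ g) := by
  intro t
  obtain ⟨x, x', rfl⟩ := exists_pair (X := X) (Y := X') t
  refine (sum_pair (X := Y) (Y := Y') _).trans ?_
  simp only [tensorHom_apply]
  rw [← Finset.sum_mul_sum, hf x, hg x', one_mul]

instance : (stochastic U).IsStableUnderBraiding where
  whiskerLeft X _ _ g hg := by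
    rw [← id_tensorHom]; exact stochastic_tensor _ _ (stochastic_fn id) hg
  whiskerRight f hf Y := by
    rw [← tensorHom_id]; exact stochastic_tensor _ _ hf (stochastic_fn id)
  associator_hom_mem _ _ _ := stochastic_fn _
  associator_inv_mem _ _ _ := stochastic_fn _
  leftUnitor_hom_mem _ := stochastic_fn _
  leftUnitor_inv_mem _ := stochastic_fn _
  rightUnitor_hom_mem _ := stochastic_fn _
  rightUnitor_inv_mem _ := stochastic_fn _
  braiding_hom_mem _ _ := stochastic_fn _
  braiding_inv_mem _ _ := stochastic_fn _

instance (X : Mat U) : (stochastic U).IsStableUnderComonoid X where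
  counit_mem := stochastic_fn _
  comul_mem := stochastic_fn _

end Mat

/-- The CD-category of finite sets and stochastic matrices. -/
abbrev FinStoch (U : Type w) : Type w := WideSubcategory (stochastic U)

/-- The inclusion of stochastic matrices into matrices. -/
noncomputable def stochInclusion (U : Type w) : FinStoch U ⥤ Mat U :=
  wideSubcategoryInclusion (stochastic U)

theorem stochInclusion_eqToHom {U : Type w} {X Y : FinStoch U} (h : X = Y) :
    (eqToHom h).hom = eqToHom (congrArg WideSubcategory.obj h) := by
  subst h; rfl

instance (U : Type w) : StrictMonoidal (FinStoch U) where
  tensor_assoc X Y Z := WideSubcategory.ext (Mat.tensor_assoc X.obj Y.obj Z.obj)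
  unit_tensor X := WideSubcategory.ext (Mat.unit_tensor X.obj)
  tensor_unit X := WideSubcategory.ext (Mat.tensor_unit X.obj)
  associator_eq X Y Z := by
    ext1
    rw [stochInclusion_eqToHom]; exact Mat.associator_eq _ _ _
  leftUnitor_eq X := by
    ext1
    rw [stochInclusion_eqToHom]; exact Mat.leftUnitor_eq _
  rightUnitor_eq X := by
    ext1
    rw [stochInclusion_eqToHom]; exact Mat.rightUnitor_eq _

/-- Proportionality of matrices: equality up to a global positive factor. -/
def proportional (U : Type w) : HomRel (Mat U) :=
  fun X Y f g => ∃ c : ℝ≥0, 0 < c ∧ ∀ (y : Y.El) (x : X.El), c * f y x = g y x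

instance (U : Type w) : Congruence (proportional U) where
  equivalence :=
    { refl := fun f => ⟨1, one_pos, fun _ _ => one_mul _⟩
      symm := by
        rintro f g ⟨c, hc, h⟩
        exact ⟨c⁻¹, inv_pos.2 hc, fun y x => by rw [← h, inv_mul_cancel_left₀ hc.ne']⟩
      trans := by
        rintro f g k ⟨c, hc, h⟩ ⟨d, hd, h'⟩
        exact ⟨d * c, mul_pos hd hc, fun y x => by rw [mul_assoc, h, h']⟩ }
  comp_left := by
    rintro X Y Z f g g' ⟨c, hc, h⟩
    refine ⟨c, hc, fun z x => ?_⟩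
    rw [Mat.comp_apply, Mat.comp_apply, Finset.mul_sum]
    simp only [← h, mul_assoc]
  comp_right := by
    rintro X Y Z f f' g ⟨c, hc, h⟩
    refine ⟨c, hc, fun z x => ?_⟩
    rw [Mat.comp_apply, Mat.comp_apply, Finset.mul_sum]
    simp only [← h, mul_left_comm]

/-- Matrices up to proportionality. -/
abbrev FinProjStoch (U : Type w) : Type w := CategoryTheory.Quotient (proportional U)

/-- The quotient functor `q`. -/
noncomputable def toProj (U : Type w) : Mat U ⥤ FinProjStoch U :=
  CategoryTheory.Quotient.functor (proportional U)

/-- The functor `i`, sending a stochastic matrix to its class. -/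
noncomputable def stochToProj (U : Type w) : FinStoch U ⥤ FinProjStoch U :=
  stochInclusion U ⋙ toProj U

/-! ### Ordered graphs -/

/-- The vertices of a finite totally ordered set that lie in `C`, in increasing order. -/
def listOf {V : Type u} [Fintype V] [LinearOrder V] (C : Finset V) : List V :=
  ((Finset.univ : Finset V).sort (· ≤ ·)).filter (· ∈ C)

/-- All vertices in increasing order. -/
def vertexList (V : Type u) [Fintype V] [LinearOrder V] : List V :=
  (Finset.univ : Finset V).sort (· ≤ ·)

/-- Ordered directed acyclic graphs: a finite set of vertices with a total order such that
`v → w` implies `v < w`. -/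
structure ODAG : Type (u + 1) where
  V : Type u
  [fintype : Fintype V]
  [linearOrder : LinearOrder V]
  Edge : V → V → Prop
  lt_of_edge : ∀ {v w : V}, Edge v w → v < w

/-- Ordered undirected graphs. -/
structure OUGr : Type (u + 1) where
  V : Type u
  [fintype : Fintype V]
  [linearOrder : LinearOrder V]
  graph : SimpleGraph V

attribute [instance] ODAG.fintype ODAG.linearOrder OUGr.fintype OUGr.linearOrder

namespace ODAG

/-- Order-preserving graph homomorphisms (which may contract edges). -/
@[ext]
structure Hom (G G' : ODAG.{u}) where
  toFun : G.V → G'.V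
  monotone : Monotone toFun
  edge : ∀ {v w : G.V}, G.Edge v w → toFun v = toFun w ∨ G'.Edge (toFun v) (toFun w)

instance : Category.{u} ODAG.{u} where
  Hom := Hom
  id G := ⟨fun v => v, monotone_id, Or.inr⟩
  comp f g := ⟨fun v => g.toFun (f.toFun v), g.monotone.comp f.monotone, fun h =>
    (f.edge h).elim (fun e => Or.inl (congrArg g.toFun e)) g.edge⟩

/-- The one-vertex graph. -/
def point : ODAG.{u} where
  V := PUnit
  Edge _ _ := False
  lt_of_edge h := h.elim

open scoped Classical in
/-- The set of parents of a vertex. -/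
noncomputable def parents (G : ODAG.{u}) (v : G.V) : Finset G.V :=
  Finset.univ.filter fun w => G.Edge w v

/-- A vertex together with its parents. -/
noncomputable def family (G : ODAG.{u}) (v : G.V) : Finset G.V := insert v (G.parents v)

theorem mem_parents {G : ODAG.{u}} {v w : G.V} : w ∈ G.parents v ↔ G.Edge w v := by
  simp [parents]

end ODAG

namespace OUGr

/-- Order-preserving graph homomorphisms (which may contract edges). -/
@[ext]
structure Hom (H H' : OUGr.{u}) where
  toFun : H.V → H'.V
  monotone : Monotone toFun
  edge : ∀ {v w : H.V}, H.graph.Adj v w → toFun v = toFun w ∨ H'.graph.Adj (toFun v) (toFun w)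

instance : Category.{u} OUGr.{u} where
  Hom := Hom
  id H := ⟨fun v => v, monotone_id, Or.inr⟩
  comp f g := ⟨fun v => g.toFun (f.toFun v), g.monotone.comp f.monotone, fun h =>
    (f.edge h).elim (fun e => Or.inl (congrArg g.toFun e)) g.edge⟩

/-- The one-vertex graph. -/
def point : OUGr.{u} where
  V := PUnit
  graph := ⊥

/-- Cliques: non-empty sets of vertices, any two distinct elements of which are adjacent. -/
abbrev Clique (H : OUGr.{u}) : Type u :=
  {C : Finset H.V // C.Nonempty ∧ H.graph.IsClique (C : Set H.V)}

end OUGr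

/-- The moralisation of an ordered DAG: same vertices and order, with an edge between distinct
vertices `v` and `w` if there is an edge between them or if they have a common child. -/
def moral (G : ODAG.{u}) : OUGr.{u} where
  V := G.V
  graph :=
    { Adj := fun v w => v ≠ w ∧ (G.Edge v w ∨ G.Edge w v ∨ ∃ x, G.Edge v x ∧ G.Edge w x)
      symm := ⟨fun _ _ h => ⟨h.1.symm, h.2.elim (fun e => Or.inr (Or.inl e)) fun h' => h'.elim Or.inl
        fun ⟨x, e, e'⟩ => Or.inr (Or.inr ⟨x, e', e⟩)⟩⟩
      loopless := ⟨fun _ h => h.1 rfl⟩ }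

/-- A morphism of ordered DAGs, regarded as a morphism between their moralisations. -/
def moralMap {G G' : ODAG.{u}} (α : G ⟶ G') : moral G ⟶ moral G' where
  toFun := α.toFun
  monotone := α.monotone
  edge := by
    rintro v w ⟨_, h⟩
    refine or_iff_not_imp_left.2 fun hne => ⟨hne, ?_⟩
    rcases h with h | h | ⟨x, h, h'⟩
    · exact Or.inl ((α.edge h).resolve_left hne)
    · exact Or.inr (Or.inl ((α.edge h).resolve_left (Ne.symm hne)))
    · rcases α.edge h with e | e <;> rcases α.edge h' with e' | e'
      · exact absurd (e.trans e'.symm) hne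
      · exact Or.inr (Or.inl (e ▸ e'))
      · exact Or.inl (e' ▸ e)
      · exact Or.inr (Or.inr ⟨_, e, e'⟩)

/-! ### Syntax categories -/

section Wires

variable {S : Signature.{u}} {hyp : Prop}

/-- The morphism deleting the wires of a list which do not satisfy `p`. -/
noncomputable def proj (hyp : Prop) (p : S.Ob → Bool) : (L : List S.Ob) →
    ((⟨L⟩ : FreeStr S hyp) ⟶ ⟨L.filter p⟩)
  | [] => 𝟙 _
  | a :: L =>
    if h : p a = true then
      (𝟙 (⟨[a]⟩ : FreeStr S hyp) ⊗ₘ proj hyp p L) ≫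
        eqToHom (FreeStr.ext (List.filter_cons_of_pos h).symm)
    else
      (ε[(⟨[a]⟩ : FreeStr S hyp)] ⊗ₘ proj hyp p L) ≫
        eqToHom (FreeStr.ext (List.filter_cons_of_neg h).symm)

/-- The morphism adding, with omni, the wires of a list which do not satisfy `p`. -/
noncomputable def pad (p : S.Ob → Bool) : (L : List S.Ob) →
    ((⟨L.filter p⟩ : FreeStr S True) ⟶ ⟨L⟩)
  | [] => 𝟙 _
  | a :: L =>
    if h : p a = true then
      eqToHom (FreeStr.ext (List.filter_cons_of_pos h)) ≫
        (𝟙 (⟨[a]⟩ : FreeStr S True) ⊗ₘ pad p L)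
    else
      eqToHom (FreeStr.ext (List.filter_cons_of_neg h)) ≫
        (η[(⟨[a]⟩ : FreeStr S True)] ⊗ₘ pad p L)

theorem liftObj_wires (L : List S.Ob) :
    liftObj (fun a => (⟨[a]⟩ : FreeStr S hyp)) L = ⟨L⟩ := by
  induction L with
  | nil => rfl
  | cons a L ih => rw [liftObj, ih]; rfl

end Wires

namespace ODAG

/-- The signature of an ordered DAG: a generator `pa(v) → v` for every vertex `v`. -/
noncomputable def signature (G : ODAG.{u}) : Signature.{u} where
  Ob := G.V
  Gen := G.V
  src v := listOf (G.parents v)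
  tgt v := [v]

/-- The free CD-category on an ordered DAG. -/
abbrev CDSyn (G : ODAG.{u}) : Type u := FreeStr G.signature False

/-- The free hypergraph category on an ordered DAG. -/
abbrev HypSyn (G : ODAG.{u}) : Type u := FreeStr G.signature True

theorem filter_initial (G : ODAG.{u}) {P Q : List G.V} {v : G.V}
    (h : P ++ v :: Q = vertexList G.V) :
    P.filter (· ∈ G.parents v) = listOf (G.parents v) := by
  have hs : (P ++ v :: Q).Pairwise (· ≤ ·) := by
    rw [h]; exact Finset.pairwise_sort _ _
  rw [listOf, ← vertexList, ← h, List.filter_append]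
  have : (v :: Q).filter (· ∈ G.parents v) = [] := by
    rw [List.filter_eq_nil_iff]
    intro w hw hwv
    have hwv := G.lt_of_edge (mem_parents.1 (of_decide_eq_true hwv))
    rcases List.mem_cons.1 hw with rfl | hw
    · exact lt_irrefl _ hwv
    · exact absurd hwv (not_lt.2 ((List.pairwise_cons.1 (List.pairwise_append.1 hs).2.1).1 w hw))
  rw [this, List.append_nil]

/-- One step of copy-composition: given an initial segment `P` of the list of vertices and the next
vertex `v`, copy all wires of `P`, delete from one of the copies those that are not parents of `v`,
and apply the generator of `v` to the others. -/
noncomputable def copyStep (G : ODAG.{u}) (hyp : Prop) (P Q : List G.V) (v : G.V)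
    (h : P ++ v :: Q = vertexList G.V) :
    (⟨P⟩ : FreeStr G.signature hyp) ⟶ ⟨P ++ [v]⟩ :=
  Δ[(⟨P⟩ : FreeStr G.signature hyp)] ≫
    (𝟙 (⟨P⟩ : FreeStr G.signature hyp) ⊗ₘ
      (proj (S := G.signature) hyp (fun w : G.V => decide (w ∈ G.parents v)) P ≫
        eqToHom (FreeStr.ext (G.filter_initial h)) ≫ FreeStr.gen (S := G.signature) hyp v))

/-- Copy-composition of the generators of the vertices in `Q`, for an initial segment `P` followed
by `Q`. -/
noncomputable def copyFrom (G : ODAG.{u}) (hyp : Prop) : (P Q : List G.V) →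
    (P ++ Q = vertexList G.V) → ((⟨P⟩ : FreeStr G.signature hyp) ⟶ ⟨P ++ Q⟩)
  | P, [], _ => eqToHom (FreeStr.ext (List.append_nil P).symm)
  | P, v :: Q, h =>
    G.copyStep hyp P Q v h ≫
      copyFrom G hyp (P ++ [v]) Q ((List.append_assoc P [v] Q).trans h) ≫
        eqToHom (FreeStr.ext (List.append_assoc P [v] Q))

/-- The copy-composition of all generators of an ordered DAG: the morphism from the unit to the
tensor product of all vertices obtained by plugging the generators together along the graph, with
every vertex as an output. -/
noncomputable def copyComposition (G : ODAG.{u}) (hyp : Prop) :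
    𝟙_ (FreeStr G.signature hyp) ⟶ ⟨vertexList G.V⟩ :=
  G.copyFrom hyp [] (vertexList G.V) rfl

theorem point_src (v : point.{u}.V) : point.signature.src v = [] := by
  refine List.filter_eq_nil_iff.2 fun w _ hw => ?_
  exact mem_parents.1 (of_decide_eq_true hw)

/-- The generating state `I ⟶ •` of the free CD-category on the one-vertex graph. -/
noncomputable def state : 𝟙_ point.{u}.CDSyn ⟶ ⟨[PUnit.unit]⟩ :=
  eqToHom (FreeStr.ext (point_src PUnit.unit).symm) ≫
    FreeStr.gen (S := point.signature) False PUnit.unit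

/-- The CD-functor `!` induced by the map from an ordered DAG to the one-vertex graph: it sends
`•` to the tensor product of all vertices, and the state to the copy-composition of all
generators. -/
noncomputable def bang (G : ODAG.{u}) : CDFunctor point.{u}.CDSyn G.CDSyn :=
  liftCD (fun _ => ⟨vertexList G.V⟩) fun v =>
    eqToHom (congrArg (liftObj _) (point_src v)) ≫ G.copyComposition False ≫
      eqToHom (liftObj_singleton (S := point.signature)
        (fun _ => (⟨vertexList G.V⟩ : G.CDSyn)) v).symm

/-- The CD-functor from the free CD-category to the free hypergraph category on an ordered DAG,
which is the identity on generators. -/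
noncomputable def star (G : ODAG.{u}) : CDFunctor G.CDSyn G.HypSyn :=
  liftCD (fun v => ⟨[v]⟩) fun v =>
    eqToHom (liftObj_wires _) ≫ FreeStr.gen True v ≫ eqToHom (liftObj_wires _).symm

end ODAG

namespace OUGr

/-- The signature of an ordered undirected graph: a generator `I → C` for every clique `C`. -/
def signature (H : OUGr.{u}) : Signature.{u} where
  Ob := H.V
  Gen := H.Clique
  src _ := []
  tgt C := listOf C.1

/-- The free hypergraph category on an ordered undirected graph. -/
abbrev Syn (H : OUGr.{u}) : Type u := FreeStr H.signature True

/-- The generator of a clique, extended by omni to all vertices. -/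
noncomputable def paddedGen (H : OUGr.{u}) (C : H.Clique) : 𝟙_ H.Syn ⟶ ⟨vertexList H.V⟩ :=
  FreeStr.gen (S := H.signature) True C ≫
    pad (S := H.signature) (fun v : H.V => decide (v ∈ C.1)) (vertexList H.V)

open scoped Classical in
/-- The compare-composition of all generators of an ordered undirected graph: all occurrences of
the same vertex as an output of generators are compared. It is written as the product of the
generators, extended by omni to all vertices, for the multiplication of `convCommMonoid`; since omni
is the unit of compare, only the outputs that actually occur are compared. -/
noncomputable def compareComposition (H : OUGr.{u}) : 𝟙_ H.Syn ⟶ ⟨vertexList H.V⟩ :=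
  (∏ C : H.Clique, (H.paddedGen C : Conv (𝟙_ H.Syn) ⟨vertexList H.V⟩) :
    Conv (𝟙_ H.Syn) ⟨vertexList H.V⟩)

theorem filter_vertexList_punit {C : Finset PUnit.{u + 1}} (hC : C.Nonempty) :
    (vertexList PUnit.{u + 1}).filter (· ∈ C) = [PUnit.unit] := by
  have h : vertexList PUnit.{u + 1} = [PUnit.unit] := Finset.sort_singleton _ _
  obtain ⟨v, hv⟩ := hC
  rw [h, List.filter_cons_of_pos (p := fun x => decide (x ∈ C)) (decide_eq_true hv),
    List.filter_nil]

theorem point_tgt (C : point.{u}.Clique) : point.signature.tgt C = [PUnit.unit] :=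
  filter_vertexList_punit C.2.1

/-- The hypergraph functor `!` induced by the map from an ordered undirected graph to the one-vertex
graph: it sends `•` to the tensor product of all vertices, and the generator `I ⟶ •` to the
compare-composition of all generators. -/
noncomputable def bang (H : OUGr.{u}) : HypergraphFunctor point.{u}.Syn H.Syn :=
  liftHypergraph (fun _ => ⟨vertexList H.V⟩) fun C =>
    H.compareComposition ≫
      eqToHom ((congrArg (liftObj (S := point.signature) fun _ => (⟨vertexList H.V⟩ : H.Syn))
        (point_tgt C)).trans (liftObj_singleton (S := point.signature) _ PUnit.unit)).symm

/-- The clique of the one-vertex graph. -/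
def pointClique : point.{u}.Clique :=
  ⟨({PUnit.unit} : Finset PUnit), Finset.singleton_nonempty _, fun v _ w _ h =>
    absurd (Subsingleton.elim (α := PUnit) v w) h⟩

/-- The CD-functor from the free CD-category to the free hypergraph category on the one-vertex
graph, sending the generator `I ⟶ •` to the generator `I ⟶ •`. -/
noncomputable def star : CDFunctor ODAG.point.{u}.CDSyn point.{u}.Syn :=
  liftCD (fun _ => ⟨[PUnit.unit]⟩) fun v =>
    eqToHom (congrArg (liftObj _) (ODAG.point_src v)) ≫
      FreeStr.gen (S := point.signature) True pointClique ≫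
        eqToHom ((liftObj_singleton (S := ODAG.point.signature) (fun _ =>
          (⟨[PUnit.unit]⟩ : point.Syn)) v).trans (FreeStr.ext (point_tgt pointClique).symm)).symm

end OUGr

/-! ### Categories of networks -/

variable (U : Type w)

/-- CD-functors from the free CD-category on the one-vertex graph to `FinStoch`; they are determined
by the probability distribution which is the image of the state. -/
abbrev Distribution := CDFunctor ODAG.point.{u}.CDSyn (FinStoch U)

/-- Distribution-preserving monoidal transformations. -/
@[ext]
structure Transformation {U : Type w} (ω ω' : Distribution.{u} U) where
  app (X : ODAG.point.{u}.CDSyn) : ω.obj X ⟶ ω'.obj X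
  app_unit : Same (app (𝟙_ _)) (𝟙 (𝟙_ (FinStoch U)))
  app_tensor (X Y : ODAG.point.{u}.CDSyn) : Same (app (X ⊗ Y)) (app X ⊗ₘ app Y)
  distribution : Same (ω.map ODAG.state ≫ app ⟨[PUnit.unit]⟩) (ω'.map ODAG.state)

namespace Transformation

variable {U}

/-- Identity transformation. -/
noncomputable def id (ω : Distribution.{u} U) : Transformation ω ω where
  app X := 𝟙 _
  app_unit := by
    have h := ω.isCD.obj_unit
    exact (same_iff _ _).2 ⟨h, h, by simp⟩
  app_tensor X Y := by
    have h := ω.isCD.obj_tensor X Y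
    exact (same_iff _ _).2 ⟨h, h, by simp⟩
  distribution := Same.of_eq (Category.comp_id _)

/-- Composition of transformations. -/
noncomputable def comp {ω ω' ω'' : Distribution.{u} U} (τ : Transformation ω ω') (θ : Transformation ω' ω'') :
    Transformation ω ω'' where
  app X := τ.app X ≫ θ.app X
  app_unit := (τ.app_unit.comp θ.app_unit).trans (Same.of_eq (Category.comp_id _))
  app_tensor X Y := ((τ.app_tensor X Y).comp (θ.app_tensor X Y)).trans
    (Same.of_eq (tensorHom_comp_tensorHom _ _ _ _))
  distribution :=
    (Same.of_eq (Category.assoc _ _ _).symm).trans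
      ((τ.distribution.comp (Same.refl _)).trans θ.distribution)

end Transformation

/-- Irredundant Bayesian networks: pairs of a distribution and an ordered DAG through whose free
CD-category the distribution factors. -/
structure BN where
  ω : Distribution.{u} U
  G : ODAG.{u}
  factors : ∃ F : CDFunctor G.CDSyn (FinStoch U), ω.toFunctor = G.bang.toFunctor ⋙ F.toFunctor

/-- Commutativity of the diagram expressing that the distribution `ω` is, up to normalisation, the
one defined by the Markov network `Φ`. -/
def MarkovDiagram {U : Type w} (ω : Distribution.{u} U) (H : OUGr.{u})
    (Φ : HypergraphFunctor H.Syn (Mat U)) : Prop :=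
  OUGr.star.toFunctor ⋙ H.bang.toFunctor ⋙ Φ.toFunctor ⋙ toProj U =
    ω.toFunctor ⋙ stochToProj U

/-- Irredundant Markov networks: pairs of a distribution and an ordered undirected graph through
whose free hypergraph category the distribution factors up to normalisation. -/
structure MN where
  ω : Distribution.{u} U
  H : OUGr.{u}
  factors : ∃ Φ : HypergraphFunctor H.Syn (Mat U), MarkovDiagram ω H Φ

namespace BN

variable {U}

/-- A morphism of Bayesian networks. -/
@[ext]
structure Hom (B B' : BN.{u} U) where
  α : B'.G ⟶ B.G
  τ : Transformation B.ω B'.ω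

noncomputable instance : Category (BN.{u} U) where
  Hom := Hom
  id B := ⟨𝟙 B.G, Transformation.id B.ω⟩
  comp f g := ⟨g.α ≫ f.α, f.τ.comp g.τ⟩
  id_comp f := by
    refine Hom.ext (Category.comp_id _) (Transformation.ext ?_); funext X; exact Category.id_comp _
  comp_id f := by
    refine Hom.ext (Category.id_comp _) (Transformation.ext ?_); funext X; exact Category.comp_id _
  assoc f g h := by
    refine Hom.ext (Category.assoc _ _ _).symm (Transformation.ext ?_)
    funext X; exact Category.assoc _ _ _

end BN

namespace MN

variable {U}

/-- A morphism of Markov networks. -/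
@[ext]
structure Hom (N N' : MN.{u} U) where
  α : N'.H ⟶ N.H
  τ : Transformation N.ω N'.ω

noncomputable instance : Category (MN.{u} U) where
  Hom := Hom
  id N := ⟨𝟙 N.H, Transformation.id N.ω⟩
  comp f g := ⟨g.α ≫ f.α, f.τ.comp g.τ⟩
  id_comp f := by
    refine Hom.ext (Category.comp_id _) (Transformation.ext ?_); funext X; exact Category.id_comp _
  comp_id f := by
    refine Hom.ext (Category.id_comp _) (Transformation.ext ?_); funext X; exact Category.comp_id _
  assoc f g h := by
    refine Hom.ext (Category.assoc _ _ _).symm (Transformation.ext ?_)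
    funext X; exact Category.assoc _ _ _

end MN

/-! ### Moralisation on syntax -/

/-- The defining clauses of the moralisation functor on syntax: it is the identity on vertices, it
sends the generator of a clique `{v} ∪ pa(v)` to the graph of the generator of `v`, and the
generators of all other cliques to omni. -/
structure IsMoralisation (G : ODAG.{u}) (m : HypergraphFunctor (moral G).Syn G.HypSyn) : Prop where
  obj (v : G.V) : m.obj ⟨[v]⟩ = ⟨[v]⟩
  map_family (C : (moral G).Clique) (v : G.V) (h : C.1 = G.family v) :
    Same (m.map (FreeStr.gen (S := (moral G).signature) True C))
      (graph (FreeStr.gen (S := G.signature) True v))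
  map_other (C : (moral G).Clique) (h : ∀ v : G.V, C.1 ≠ G.family v) :
    Same (m.map (FreeStr.gen (S := (moral G).signature) True C)) η[(⟨listOf (V := G.V) C.1⟩ : G.HypSyn)]

/-- `Ft` is the hypergraph functor defined on generators in the same way as the CD-functor `F`. -/
def IsHypergraphExtension {U : Type w} {G : ODAG.{u}} (F : CDFunctor G.CDSyn (FinStoch U))
    (Ft : HypergraphFunctor G.HypSyn (Mat U)) : Prop :=
  G.star.toFunctor ⋙ Ft.toFunctor = F.toFunctor ⋙ stochInclusion U

end PGM

/-! In a hypergraph category the states `I ⟶ X` form a commutative monoid: the product compares two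
states, and omni is the unit. The proof turns both compositions of generators into products in this
monoid on the tensor product of all vertices, and then compares the factors.

The bridge is `comp_copy_comp`. By the Frobenius law, copying a state and feeding one copy into `f`
is the same as extending the state by omni and comparing it with the graph of `f`. In one step of
copy-composition `f` is a generator preceded by the deletion of the wires that are not parents.
Deletion and omni are transposes of each other (`isTranspose_proj_pad`), so the graph of this `f` is
the graph of the generator, padded by omni on the other wires. Induction along the order of the
vertices (`same_comp_copyFrom`) gives `copyComposition_eq`: the copy-composition is the product of
the padded graphs of all generators.

The compare-composition for the moral graph is by definition the product of all padded clique
generators, and hypergraph functors preserve convolution products. The moralisation functor sends a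
clique to a graph or to omni. The omni factors are the unit of the product. The families `{v} ∪
pa(v)` are cliques because the common child `v` marries its parents, and they are pairwise distinct
by acyclicity. Hence exactly one factor remains for each vertex (`prod_paddedCliqueState`), and the
syntactic square commutes (`star_bang_moralisation`).

Everything else is freeness. A functor on a free category is determined by its generators, which
gives both uniqueness claims and the extension of `F` to matrices. Pasting the syntactic square with
this extension gives the diagram for the Markov network. It commutes already in matrices, before
passing to proportionality classes. On networks, moralisation leaves vertex maps and transformations
unchanged, so functoriality is immediate. -/

namespace PGM

/-! ### Equality of morphisms across equal objects: strictness and structure maps. -/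

section SameLemmas

variable {C : Type u₁} [Category.{v₁} C]

theorem Same.id {X X' : C} (h : X = X') : Same (𝟙 X) (𝟙 X') := by subst h; rfl

theorem Same.eqToHom_comp_eqToHom {X X' Y Y' : C} (h : X = X') (f : X' ⟶ Y') (k : Y' = Y) :
    Same (CategoryTheory.eqToHom h ≫ f ≫ CategoryTheory.eqToHom k) f :=
  (Same.eqToHom_comp _ _).trans (Same.comp_eqToHom _ _)

variable [MonoidalCategory C]

/-- Naturality of the left unitor; in a strict category the unitor is an `eqToHom`, which `Same`
ignores. The next two lemmas use the right unitor and the associator in the same way. -/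
theorem Same.unit_tensorHom [StrictMonoidal C] {X Y : C} (f : X ⟶ Y) :
    Same (𝟙 (𝟙_ C) ⊗ₘ f) f := by
  have h := MonoidalCategory.leftUnitor_naturality f
  rw [StrictMonoidal.leftUnitor_eq, StrictMonoidal.leftUnitor_eq] at h
  rw [id_tensorHom]
  exact (Same.comp_eqToHom _ _).symm.trans ((Same.of_eq h).trans (Same.eqToHom_comp _ _))

theorem Same.tensorHom_unit [StrictMonoidal C] {X Y : C} (f : X ⟶ Y) :
    Same (f ⊗ₘ 𝟙 (𝟙_ C)) f := by
  have h := MonoidalCategory.rightUnitor_naturality f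
  rw [StrictMonoidal.rightUnitor_eq, StrictMonoidal.rightUnitor_eq] at h
  rw [tensorHom_id]
  exact (Same.comp_eqToHom _ _).symm.trans ((Same.of_eq h).trans (Same.eqToHom_comp _ _))

theorem Same.tensorHom_assoc [StrictMonoidal C] {X Y X' Y' X'' Y'' : C} (f : X ⟶ Y)
    (f' : X' ⟶ Y') (f'' : X'' ⟶ Y'') : Same ((f ⊗ₘ f') ⊗ₘ f'') (f ⊗ₘ (f' ⊗ₘ f'')) := by
  have h := MonoidalCategory.associator_naturality f f' f''
  rw [StrictMonoidal.associator_eq, StrictMonoidal.associator_eq] at h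
  exact (Same.comp_eqToHom _ _).symm.trans ((Same.of_eq h).trans (Same.eqToHom_comp _ _))

theorem Same.copy [CopyDiscardCategory C] {X X' : C} (h : X = X') : Same Δ[X] Δ[X'] := by
  subst h; rfl

theorem Same.delete [CopyDiscardCategory C] {X X' : C} (h : X = X') : Same ε[X] ε[X'] := by
  subst h; rfl

theorem Same.braiding [CopyDiscardCategory C] {X X' Y Y' : C} (h : X = X') (k : Y = Y') :
    Same (β_ X Y).hom (β_ X' Y').hom := by
  subst h k; rfl

variable [CopyDiscardCategory C] [HypergraphCategory C]

theorem Same.compare {X X' : C} (h : X = X') : Same μ[X] μ[X'] := by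
  subst h; rfl

theorem Same.omni {X X' : C} (h : X = X') : Same η[X] η[X'] := by
  subst h; rfl

theorem Same.graph {X Y X' Y' : C} {f : X ⟶ Y} {g : X' ⟶ Y'} (h : Same f g) :
    Same (PGM.graph f) (PGM.graph g) := by
  obtain ⟨rfl, rfl, rfl⟩ := (same_iff f g).1 h
  exact Same.of_eq (by simp)

/-- The convolution product of morphisms. -/
def conv {X Y : C} (f g : X ⟶ Y) : X ⟶ Y := Δ[X] ≫ f ▷ X ≫ Y ◁ g ≫ μ[Y]

theorem Same.conv {X Y X' Y' : C} {f g : X ⟶ Y} {f' g' : X' ⟶ Y'}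
    (h : Same f f') (k : Same g g') :
    Same (conv f g) (conv f' g') := by
  obtain ⟨rfl, rfl, rfl⟩ := (same_iff f f').1 h
  obtain ⟨_, _, rfl⟩ := (same_iff g g').1 k
  exact Same.of_eq (by simp)

end SameLemmas

/-! ### Convolution of states -/

section Convolution

variable {C : Type u₁} [Category.{v₁} C] [MonoidalCategory C] [CopyDiscardCategory C]
  [HypergraphCategory C]

/-- The endomorphism of `X` comparing its input with a state. -/
def act {X : C} (s : 𝟙_ C ⟶ X) : X ⟶ X := (λ_ X).inv ≫ s ▷ X ≫ μ[X]

/-- Copy on the unit is a unitor, so by interchange `t` can be performed before `s`. Convolution of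
states thereby becomes composition with an endomorphism, which is easier to move through diagrams.
-/
theorem conv_eq_comp_act {X : C} (s t : 𝟙_ C ⟶ X) :
    conv s t = t ≫ act s := by
  rw [conv, CopyDiscardCategory.copy_unit, act, ← whisker_exchange_assoc,
    ← leftUnitor_inv_naturality_assoc]

theorem act_omni (X : C) : act η[X] = 𝟙 X := by simp [act]

theorem omni_comp_act {X : C} (s : 𝟙_ C ⟶ X) : η[X] ≫ act s = s := by
  rw [act, leftUnitor_inv_naturality_assoc, whisker_exchange_assoc, MonObj.mul_one, unitors_inv_equal]
  simp

/-- Compare on a tensor product is componentwise up to the exchange `tensorμ`, which is natural and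
compatible with the unitors. -/
theorem act_tensor {X Y : C} (s : 𝟙_ C ⟶ X) (t : 𝟙_ C ⟶ Y) :
    act ((λ_ (𝟙_ C)).inv ≫ (s ⊗ₘ t)) = (act s ⊗ₘ act t) := by
  -- Unit coherence of `tensorμ`: it distributes the unit over the two factors.
  have h : (λ_ (X ⊗ Y)).inv ≫ (λ_ (𝟙_ C)).inv ▷ (X ⊗ Y) ≫ tensorμ (𝟙_ C) (𝟙_ C) X Y =
      ((λ_ X).inv ⊗ₘ (λ_ Y).inv) := by
    rw [Iso.inv_comp_eq, tensor_left_unitality]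
    simp only [Category.assoc, tensorHom_comp_tensorHom, Iso.hom_inv_id, id_tensorHom_id,
      Category.comp_id]
  have h' : (s ⊗ₘ t) ▷ (X ⊗ Y) ≫ tensorμ X Y X Y =
      tensorμ (𝟙_ C) (𝟙_ C) X Y ≫ (s ▷ X ⊗ₘ t ▷ Y) := by
    rw [← tensorHom_id, ← id_tensorHom_id, tensorμ_natural, tensorHom_id, tensorHom_id]
  rw [act, comp_whiskerRight_assoc, HypergraphCategory.compare_tensor, reassoc_of% h']
  simp only [act, ← tensorHom_comp_tensorHom, ← h, Category.assoc]

/-- The Frobenius law: comparing with a state and then copying equals copying and then comparing on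
one branch. This is the only place where the convolution argument uses it. -/
theorem act_comp_copy {X : C} (s : 𝟙_ C ⟶ X) : act s ≫ Δ[X] = Δ[X] ≫ act s ▷ X := by
  simp only [act, Category.assoc, ← HypergraphCategory.frobenius_right, comp_whiskerRight]
  rw [← whisker_exchange_assoc, ← leftUnitor_inv_naturality_assoc]
  simp

/-- Comparison is componentwise, and omni acts trivially on the second factor. It is used for the
wires that later generators have yet to constrain. -/
theorem conv_tensor_omni {X : C} (Y : C) (s t : 𝟙_ C ⟶ X) :
    conv ((λ_ (𝟙_ C)).inv ≫ (s ⊗ₘ η[Y])) ((λ_ (𝟙_ C)).inv ≫ (t ⊗ₘ η[Y])) =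
      (λ_ (𝟙_ C)).inv ≫ (conv s t ⊗ₘ η[Y]) := by
  rw [conv_eq_comp_act, conv_eq_comp_act, act_tensor, act_omni, Category.assoc,
    tensorHom_comp_tensorHom, Category.comp_id]

/-- Feeding a copy of a state into a morphism amounts to comparing the state with the graph. -/
theorem comp_copy_comp {X Y : C} (s : 𝟙_ C ⟶ X) (f : X ⟶ Y) :
    s ≫ Δ[X] ≫ (𝟙 X ⊗ₘ f) =
      conv ((λ_ (𝟙_ C)).inv ≫ (s ⊗ₘ η[Y])) (graph f) := by
  -- The right side is now `graph f` followed by `act s` on the first wire. This endomorphism slides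
  -- past `f`, then back through the copy by `act_comp_copy`, and on reaching omni becomes `s`.
  rw [conv_eq_comp_act, act_tensor, act_omni]
  unfold PGM.graph
  rw [tensorHom_id, Category.assoc, Category.assoc, id_tensorHom, whisker_exchange,
    ← reassoc_of% (act_comp_copy s), reassoc_of% (omni_comp_act s)]

/-- `p` and `q` are transposes of each other for the self-dualities given by omni and copy. -/
def IsTranspose {X Y : C} (p : X ⟶ Y) (q : Y ⟶ X) : Prop :=
  η[X] ≫ Δ[X] ≫ (𝟙 X ⊗ₘ p) = η[Y] ≫ Δ[Y] ≫ (q ⊗ₘ 𝟙 Y)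

theorem isTranspose_id (X : C) : IsTranspose (𝟙 X) (𝟙 X) := rfl

/-- Deleting one branch of a copy leaves the wire alone, so bending `ε` gives bare omni; the other
side is omni on the unit followed by `η`. -/
theorem isTranspose_delete (X : C) : IsTranspose ε[X] η[X] := by
  rw [IsTranspose, id_tensorHom, tensorHom_id, ComonObj.comul_counit, HypergraphCategory.omni_unit,
    CopyDiscardCategory.copy_unit, Category.id_comp, unitors_inv_equal,
    ← rightUnitor_inv_naturality]

/-- Copy and omni on a tensor product are componentwise up to `tensorμ`; naturality of `tensorμ`
separates the two factors. -/
theorem IsTranspose.tensor {X Y X' Y' : C} {p : X ⟶ Y} {q : Y ⟶ X} {p' : X' ⟶ Y'} {q' : Y' ⟶ X'}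
    (h : IsTranspose p q) (h' : IsTranspose p' q') : IsTranspose (p ⊗ₘ p') (q ⊗ₘ q') := by
  unfold IsTranspose at *
  rw [CopyDiscardCategory.copy_tensor, CopyDiscardCategory.copy_tensor,
    HypergraphCategory.omni_tensor, HypergraphCategory.omni_tensor]
  simp only [Category.assoc]
  rw [← id_tensorHom_id X X', ← tensorμ_natural, ← id_tensorHom_id Y Y', ← tensorμ_natural]
  simp only [tensorHom_comp_tensorHom_assoc]
  rw [h, h']

theorem IsTranspose.of_same {X Y X' Y' : C} {p : X ⟶ Y} {q : Y ⟶ X} {p' : X' ⟶ Y'} {q' : Y' ⟶ X'}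
    (h : IsTranspose p q) (hp : Same p p') (hq : Same q q') : IsTranspose p' q' := by
  obtain ⟨rfl, rfl, rfl⟩ := (same_iff p p').1 hp
  obtain ⟨_, _, rfl⟩ := (same_iff q q').1 hq
  simpa using h

/-- Bending the input of `p ≫ f` lets `p` slide around the bend, where it reappears as `q` on the
other leg. -/
theorem IsTranspose.graph_comp {X Y Z : C} {p : X ⟶ Y} {q : Y ⟶ X} (h : IsTranspose p q)
    (f : Y ⟶ Z) : graph (p ≫ f) = graph f ≫ (q ⊗ₘ 𝟙 Z) := by
  unfold IsTranspose at h
  have e : (𝟙 X ⊗ₘ p ≫ f) = (𝟙 X ⊗ₘ p) ≫ (𝟙 X ⊗ₘ f) := by simp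
  have e' : (q ⊗ₘ 𝟙 Y) ≫ (𝟙 X ⊗ₘ f) = (𝟙 Y ⊗ₘ f) ≫ (q ⊗ₘ 𝟙 Z) := by
    rw [tensorHom_comp_tensorHom, tensorHom_comp_tensorHom]; simp
  unfold PGM.graph
  rw [e, reassoc_of% h, e', Category.assoc, Category.assoc]

/-! ### Images of convolution products under hypergraph functors. -/

variable {D : Type u₂} [Category.{v₂} D] [MonoidalCategory D] [CopyDiscardCategory D]
  [HypergraphCategory D]

theorem same_map_conv_one {F : C ⥤ D} (hF : IsHypergraphFunctor F) {X Y : C} {X' Y' : D}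
    (hX : F.obj X = X') (hY : F.obj Y = Y') :
    Same (F.map (1 : Conv X Y)) (1 : Conv X' Y') := by
  rw [Conv.one_eq, Conv.one_eq]
  erw [F.map_comp]
  exact ((hF.map_delete X).trans (Same.delete hX)).comp ((hF.map_omni Y).trans (Same.omni hY))

theorem same_map_conv_mul {F : C ⥤ D} (hF : IsHypergraphFunctor F) {X Y : C} {X' Y' : D}
    (hX : F.obj X = X') (hY : F.obj Y = Y') {f g : X ⟶ Y} {f' g' : X' ⟶ Y'}
    (hf : Same (F.map f) f') (hg : Same (F.map g) g') :
    Same (F.map (conv f g)) (conv f' g') := by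
  rw [conv, conv, ← tensorHom_id, ← tensorHom_id, ← id_tensorHom, ← id_tensorHom]
  rw [F.map_comp, F.map_comp, F.map_comp]
  refine ((hF.map_copy X).trans (Same.copy hX)).comp <| Same.comp ?_ <| Same.comp ?_
    ((hF.map_compare Y).trans (Same.compare hY))
  · refine (hF.map_tensor _ _).trans (hf.tensor ?_)
    rw [F.map_id]; exact Same.id hX
  · refine (hF.map_tensor _ _).trans (Same.tensor ?_ hg)
    rw [F.map_id]; exact Same.id hY

/-- Unit and product of convolution are built from copy, delete, compare and omni, which a
hypergraph functor preserves. The object equalities are parameters because the functors at hand fix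
objects only propositionally. -/
theorem same_map_conv_prod {F : C ⥤ D} (hF : IsHypergraphFunctor F) {X Y : C} {X' Y' : D}
    (hX : F.obj X = X') (hY : F.obj Y = Y') {J : Type*} (s : Finset J) (f : J → Conv X Y)
    (f' : J → Conv X' Y') (hf : ∀ i, Same (F.map (f i)) (Y' := Y') (f' i)) :
    Same (F.map (∏ i ∈ s, f i : Conv X Y)) (Y' := Y') (∏ i ∈ s, f' i : Conv X' Y') := by
  classical
  induction s using Finset.induction_on with
  | empty => exact same_map_conv_one hF hX hY
  | insert a s ha ih =>
    rw [Finset.prod_insert ha, Finset.prod_insert ha]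
    exact same_map_conv_mul hF hX hY (hf a) ih

end Convolution

/-! ### Functors on free categories are determined by the generators -/

section Ext

variable {C : Type u₁} [Category.{v₁} C] [MonoidalCategory C] [CopyDiscardCategory C]
  {D : Type u₂} [Category.{v₂} D] [MonoidalCategory D] [CopyDiscardCategory D]
  {E : Type u₃} [Category.{v₃} E] [MonoidalCategory E] [CopyDiscardCategory E]

theorem IsCDFunctor.comp {F : C ⥤ D} {G : D ⥤ E} (hF : IsCDFunctor F) (hG : IsCDFunctor G) :
    IsCDFunctor (F ⋙ G) where
  obj_unit := (congrArg G.obj hF.obj_unit).trans hG.obj_unit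
  obj_tensor X Y := (congrArg G.obj (hF.obj_tensor X Y)).trans (hG.obj_tensor _ _)
  map_tensor f g := ((hF.map_tensor f g).map G).trans (hG.map_tensor _ _)
  map_braiding X Y := ((hF.map_braiding X Y).map G).trans (hG.map_braiding _ _)
  map_copy X := ((hF.map_copy X).map G).trans (hG.map_copy _)
  map_delete X := ((hF.map_delete X).map G).trans (hG.map_delete _)

variable {S : Signature.{u}} {hyp : Prop}

/-- Every object of the free category is a tensor product of one-element lists. -/
theorem obj_eq_of_generators {F G : FreeStr S hyp ⥤ D} (hF : IsCDFunctor F) (hG : IsCDFunctor G)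
    (ho : ∀ a : S.Ob, F.obj ⟨[a]⟩ = G.obj ⟨[a]⟩) (L : List S.Ob) : F.obj ⟨L⟩ = G.obj ⟨L⟩ := by
  induction L with
  | nil => exact hF.obj_unit.trans hG.obj_unit.symm
  | cons a L ih =>
    have h := hF.obj_tensor (⟨[a]⟩ : FreeStr S hyp) ⟨L⟩
    rw [ho a, ih] at h
    exact h.trans (hG.obj_tensor (⟨[a]⟩ : FreeStr S hyp) ⟨L⟩).symm

/-- CD-functors on a free category that preserve compare and omni in the same way, if these are
available, are equal when they agree on the generators. -/
theorem functor_eq_of_generators {F G : FreeStr S hyp ⥤ D} (hF : IsCDFunctor F)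
    (hG : IsCDFunctor G) (ho : ∀ a : S.Ob, F.obj ⟨[a]⟩ = G.obj ⟨[a]⟩)
    (hc : ∀ (h : hyp) (X : List S.Ob), F.obj ⟨X⟩ = G.obj ⟨X⟩ →
      Same (F.map (FreeStr.ofTerm (X := ⟨X ++ X⟩) (Y := ⟨X⟩) (.compare h X)))
        (G.map (FreeStr.ofTerm (X := ⟨X ++ X⟩) (Y := ⟨X⟩) (.compare h X))))
    (hm : ∀ (h : hyp) (X : List S.Ob), F.obj ⟨X⟩ = G.obj ⟨X⟩ →
      Same (F.map (FreeStr.ofTerm (X := ⟨[]⟩) (Y := ⟨X⟩) (.omni h X)))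
        (G.map (FreeStr.ofTerm (X := ⟨[]⟩) (Y := ⟨X⟩) (.omni h X))))
    (hg : ∀ s : S.Gen, Same (F.map (FreeStr.gen hyp s)) (G.map (FreeStr.gen hyp s))) : F = G := by
  have hobj := obj_eq_of_generators hF hG ho
  -- Every morphism is represented by a term, so agreement follows by induction on terms; `Same`
  -- absorbs the equalities `hobj` between sources and targets.
  have key : ∀ {X Y : List S.Ob} (f : FreeTerm S hyp X Y),
      Same (F.map (FreeStr.ofTerm (X := ⟨X⟩) (Y := ⟨Y⟩) f))
        (G.map (FreeStr.ofTerm (X := ⟨X⟩) (Y := ⟨Y⟩) f)) := by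
    intro X Y f
    induction f with
    | cast h =>
      subst h
      exact (Same.of_eq (F.map_id _)).trans
        ((Same.id (hobj _)).trans (Same.of_eq (G.map_id _)).symm)
    | comp f g ihf ihg =>
      exact (Same.of_eq (F.map_comp _ _)).trans
        ((ihf.comp ihg).trans (Same.of_eq (G.map_comp _ _)).symm)
    | tensor f g ihf ihg =>
      exact (hF.map_tensor _ _).trans ((ihf.tensor ihg).trans (hG.map_tensor _ _).symm)
    | braid X Y =>
      exact (hF.map_braiding ⟨X⟩ ⟨Y⟩).trans
        ((Same.braiding (hobj X) (hobj Y)).trans (hG.map_braiding ⟨X⟩ ⟨Y⟩).symm)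
    | copy X =>
      exact (hF.map_copy ⟨X⟩).trans ((Same.copy (hobj X)).trans (hG.map_copy ⟨X⟩).symm)
    | delete X =>
      exact (hF.map_delete ⟨X⟩).trans ((Same.delete (hobj X)).trans (hG.map_delete ⟨X⟩).symm)
    | compare h X => exact hc h X (hobj X)
    | omni h X => exact hm h X (hobj X)
    | gen s => exact hg s
  refine CategoryTheory.Functor.ext (fun X => hobj X.of) ?_
  rintro X Y ⟨f⟩
  obtain ⟨_, _, h⟩ := (same_iff _ _).1 (key f)
  exact h

theorem cdFunctor_eq_of_generators {F G : FreeStr S False ⥤ D} (hF : IsCDFunctor F)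
    (hG : IsCDFunctor G) (ho : ∀ a : S.Ob, F.obj ⟨[a]⟩ = G.obj ⟨[a]⟩)
    (hg : ∀ s : S.Gen, Same (F.map (FreeStr.gen False s)) (G.map (FreeStr.gen False s))) :
    F = G :=
  functor_eq_of_generators hF hG ho (fun h => h.elim) (fun h => h.elim) hg

theorem hypergraphFunctor_eq_of_generators [HypergraphCategory D] {F G : FreeStr S True ⥤ D}
    (hF : IsHypergraphFunctor F) (hG : IsHypergraphFunctor G)
    (ho : ∀ a : S.Ob, F.obj ⟨[a]⟩ = G.obj ⟨[a]⟩)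
    (hg : ∀ s : S.Gen, Same (F.map (FreeStr.gen True s)) (G.map (FreeStr.gen True s))) :
    F = G :=
  functor_eq_of_generators hF.toIsCDFunctor hG.toIsCDFunctor ho
    (fun _ X h => (hF.map_compare ⟨X⟩).trans ((Same.compare h).trans (hG.map_compare ⟨X⟩).symm))
    (fun _ X h => (hF.map_omni ⟨X⟩).trans ((Same.omni h).trans (hG.map_omni ⟨X⟩).symm)) hg

theorem HypergraphFunctor.toFunctor_injective [HypergraphCategory C] [HypergraphCategory D]
    {F G : HypergraphFunctor C D} (h : F.toFunctor = G.toFunctor) : F = G := by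
  cases F; cases G; cases h; rfl

theorem stochInclusion_isCD (U : Type w) : IsCDFunctor (stochInclusion U) where
  obj_unit := rfl
  obj_tensor _ _ := rfl
  map_tensor _ _ := Same.refl _
  map_braiding _ _ := Same.refl _
  map_copy _ := Same.refl _
  map_delete _ := Same.refl _

end Ext

/-! ### Deleting wires and padding them with omni. -/

section Wires

variable {S : Signature.{u}} {hyp : Prop}

theorem same_proj_cons_pos {p : S.Ob → Bool} {a : S.Ob} (L : List S.Ob) (h : p a = true) :
    Same (proj hyp p (a :: L)) (𝟙 (⟨[a]⟩ : FreeStr S hyp) ⊗ₘ proj hyp p L) := by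
  rw [proj, dif_pos h]
  exact Same.comp_eqToHom (𝟙 (⟨[a]⟩ : FreeStr S hyp) ⊗ₘ proj hyp p L) _

theorem same_proj_cons_neg {p : S.Ob → Bool} {a : S.Ob} (L : List S.Ob) (h : ¬ p a = true) :
    Same (proj hyp p (a :: L)) (ε[(⟨[a]⟩ : FreeStr S hyp)] ⊗ₘ proj hyp p L) := by
  rw [proj, dif_neg h]
  exact Same.comp_eqToHom (ε[(⟨[a]⟩ : FreeStr S hyp)] ⊗ₘ proj hyp p L) _

theorem same_pad_cons_pos {p : S.Ob → Bool} {a : S.Ob} (L : List S.Ob) (h : p a = true) :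
    Same (pad p (a :: L)) (𝟙 (⟨[a]⟩ : FreeStr S True) ⊗ₘ pad p L) := by
  rw [pad, dif_pos h]
  exact Same.eqToHom_comp _ (𝟙 (⟨[a]⟩ : FreeStr S True) ⊗ₘ pad p L)

theorem same_pad_cons_neg {p : S.Ob → Bool} {a : S.Ob} (L : List S.Ob) (h : ¬ p a = true) :
    Same (pad p (a :: L)) (η[(⟨[a]⟩ : FreeStr S True)] ⊗ₘ pad p L) := by
  rw [pad, dif_neg h]
  exact Same.eqToHom_comp _ (η[(⟨[a]⟩ : FreeStr S True)] ⊗ₘ pad p L)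

/-- Wire by wire, an identity is its own transpose and a deletion is the transpose of omni. This
turns the deletions in copy-composition into the omni padding of compare-composition. -/
theorem isTranspose_proj_pad (p : S.Ob → Bool) (L : List S.Ob) :
    IsTranspose (proj True p L) (pad p L) := by
  induction L with
  | nil => exact isTranspose_id (⟨[]⟩ : FreeStr S True)
  | cons a L ih =>
    by_cases h : p a = true
    · exact ((isTranspose_id (⟨[a]⟩ : FreeStr S True)).tensor ih).of_same
        (same_proj_cons_pos L h).symm (same_pad_cons_pos L h).symm
    · exact ((isTranspose_delete (⟨[a]⟩ : FreeStr S True)).tensor ih).of_same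
        (same_proj_cons_neg L h).symm (same_pad_cons_neg L h).symm

theorem same_omni_append (L M : List S.Ob) :
    Same η[(⟨L ++ M⟩ : FreeStr S True)]
      (η[(⟨L⟩ : FreeStr S True)] ⊗ₘ η[(⟨M⟩ : FreeStr S True)]) := by
  have h := HypergraphCategory.omni_tensor (⟨L⟩ : FreeStr S True) ⟨M⟩
  rw [leftUnitor_inv_eq] at h
  exact (Same.of_eq h).trans (Same.eqToHom_comp _ _)

theorem same_pad_append (p : S.Ob → Bool) (L M : List S.Ob) :
    Same (pad p (L ++ M)) (pad p L ⊗ₘ pad p M) := by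
  induction L with
  | nil => exact (Same.unit_tensorHom _).symm
  | cons a L ih =>
    by_cases h : p a = true
    · exact (same_pad_cons_pos (L ++ M) h).trans <| ((Same.refl _).tensor ih).trans <|
        (Same.tensorHom_assoc _ _ _).symm.trans ((same_pad_cons_pos L h).symm.tensor (Same.refl _))
    · exact (same_pad_cons_neg (L ++ M) h).trans <| ((Same.refl _).tensor ih).trans <|
        (Same.tensorHom_assoc _ _ _).symm.trans ((same_pad_cons_neg L h).symm.tensor (Same.refl _))

/-- Used to exchange a family for its set of parents on an initial segment, where the two have the
same members. -/
theorem same_pad_congr {p q : S.Ob → Bool} {L : List S.Ob} (h : ∀ a ∈ L, p a = q a) :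
    Same (pad p L) (pad q L) := by
  induction L with
  | nil => exact Same.refl _
  | cons a L ih =>
    have ih := ih fun b hb => h b (List.mem_cons_of_mem _ hb)
    have ha := h a List.mem_cons_self
    by_cases h : p a = true
    · exact (same_pad_cons_pos L h).trans <| ((Same.refl _).tensor ih).trans
        (same_pad_cons_pos L (ha ▸ h)).symm
    · exact (same_pad_cons_neg L h).trans <| ((Same.refl _).tensor ih).trans
        (same_pad_cons_neg L (ha ▸ h)).symm

theorem same_pad_false {p : S.Ob → Bool} {L : List S.Ob} (h : ∀ a ∈ L, ¬ p a = true) :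
    Same (pad p L) η[(⟨L⟩ : FreeStr S True)] := by
  induction L with
  | nil => exact (Same.of_eq HypergraphCategory.omni_unit).symm
  | cons a L ih =>
    exact (same_pad_cons_neg L (h a List.mem_cons_self)).trans <|
      ((Same.refl _).tensor (ih fun b hb => h b (List.mem_cons_of_mem _ hb))).trans
        (same_omni_append [a] L).symm

/-- Omni on the kept wires and omni on the added ones together make omni on all. This makes the
cliques sent to omni neutral in the product. -/
theorem same_omni_comp_pad (p : S.Ob → Bool) (L : List S.Ob) :
    Same (η[(⟨L.filter p⟩ : FreeStr S True)] ≫ pad p L) η[(⟨L⟩ : FreeStr S True)] := by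
  induction L with
  | nil => exact Same.of_eq (Category.comp_id _)
  | cons a L ih =>
    by_cases h : p a = true
    · refine Same.trans ((Same.omni (FreeStr.ext (List.filter_cons_of_pos h))).comp
        (same_pad_cons_pos L h)) ?_
      refine Same.trans ((same_omni_append [a] (L.filter p)).comp (Same.refl _)) ?_
      refine (Same.of_eq (tensorHom_comp_tensorHom _ _ _ _)).trans ?_
      rw [Category.comp_id]
      exact ((Same.refl _).tensor ih).trans (same_omni_append [a] L).symm
    · refine Same.trans ((Same.omni (FreeStr.ext (List.filter_cons_of_neg h))).comp
        (same_pad_cons_neg L h)) ?_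
      -- The head wire is not kept, so the first factor has no wire there. Inserting the identity of
      -- the unit in its place allows a componentwise composition.
      refine Same.trans ((Same.unit_tensorHom _).symm.comp (Same.refl _)) ?_
      refine (Same.of_eq (tensorHom_comp_tensorHom _ _ _ _)).trans ?_
      rw [Category.id_comp]
      exact ((Same.refl _).tensor ih).trans (same_omni_append [a] L).symm

end Wires

/-! ### Position of a vertex in the ordered list of all vertices. -/

section VertexList

variable {V : Type u} [Fintype V] [LinearOrder V]

theorem pairwise_vertexList : (vertexList V).Pairwise (· < ·) := by
  have h := Finset.sortedLT_sort (Finset.univ : Finset V)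
  exact h.pairwise

theorem lt_of_mem_left {P Q : List V} {v : V} (h : P ++ v :: Q = vertexList V) {x : V}
    (hx : x ∈ P) : x < v := by
  have hs := pairwise_vertexList (V := V)
  rw [← h, List.pairwise_append] at hs
  exact hs.2.2 x hx v List.mem_cons_self

theorem lt_of_mem_right {P Q : List V} {v : V} (h : P ++ v :: Q = vertexList V) {x : V}
    (hx : x ∈ Q) : v < x := by
  have hs := pairwise_vertexList (V := V)
  rw [← h, List.pairwise_append] at hs
  exact (List.pairwise_cons.1 hs.2.1).1 x hx

theorem mem_vertexList (v : V) : v ∈ vertexList V := by simp [vertexList]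

end VertexList

/-! ### Copy-composition as a convolution product of padded graphs. -/

namespace ODAG

variable (G : ODAG.{u})

theorem mem_family {G : ODAG.{u}} {v x : G.V} : x ∈ G.family v ↔ x = v ∨ G.Edge x v := by
  rw [family, Finset.mem_insert, mem_parents]

theorem mem_family_left {G : ODAG.{u}} {P Q : List G.V} {v : G.V}
    (h : P ++ v :: Q = vertexList G.V) {x : G.V} (hx : x ∈ P) :
    x ∈ G.family v ↔ x ∈ G.parents v := by
  rw [mem_family, mem_parents, or_iff_right (lt_of_mem_left h hx).ne]

theorem not_mem_family_right {G : ODAG.{u}} {P Q : List G.V} {v : G.V}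
    (h : P ++ v :: Q = vertexList G.V) {x : G.V} (hx : x ∈ Q) : x ∉ G.family v := by
  rw [mem_family]
  rintro (rfl | e)
  · exact lt_irrefl _ (lt_of_mem_right h hx)
  · exact lt_asymm (lt_of_mem_right h hx) (G.lt_of_edge e)

/-- Edges increase in the order, so `v` comes after all its parents. The outputs of the graph of the
generator of `v` are therefore already in the order that the clique requires. -/
theorem listOf_family (v : G.V) : listOf (G.family v) = listOf (G.parents v) ++ [v] := by
  obtain ⟨P, Q, h⟩ := List.append_of_mem (mem_vertexList v)
  rw [← G.filter_initial h.symm, listOf, ← vertexList, h, List.filter_append,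
    List.filter_cons_of_pos (by simp [family]), List.filter_congr (q := (· ∈ G.parents v))
      fun x hx => by simp only [mem_family_left h.symm hx],
    (List.filter_eq_nil_iff (l := Q)).2 fun x hx => by simpa using not_mem_family_right h.symm hx]

/-- If two distinct vertices had the same family, each would be a parent of the other, contradicting
the order. -/
theorem family_injective : Function.Injective G.family := by
  intro v x h
  rcases mem_family.1 (h ▸ mem_family.2 (Or.inl rfl) : v ∈ G.family x) with e | e
  · exact e
  · rcases mem_family.1 (h ▸ mem_family.2 (Or.inl rfl) : x ∈ G.family v) with e' | e'
    · exact e'.symm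
    · exact absurd (G.lt_of_edge e) (lt_asymm (G.lt_of_edge e'))

/-- The graph of the generator of a vertex, extended by omni to all vertices. -/
noncomputable def paddedGraph (v : G.V) : 𝟙_ G.HypSyn ⟶ ⟨vertexList G.V⟩ :=
  graph (FreeStr.gen (S := G.signature) True v) ≫
    eqToHom (FreeStr.ext (G.listOf_family v).symm) ≫
      pad (S := G.signature) (fun x : G.V => decide (x ∈ G.family v)) (vertexList G.V)

/-- Split at `v`: before `v` the family consists of the parents, `v` itself is kept, and nothing
after `v` belongs to the family. -/
theorem same_pad_family {P Q : List G.V} {v : G.V} (h : P ++ v :: Q = vertexList G.V) :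
    Same (pad (S := G.signature) (fun x : G.V => decide (x ∈ G.family v)) (vertexList G.V))
      ((pad (S := G.signature) (fun x : G.V => decide (x ∈ G.parents v)) P ⊗ₘ
        𝟙 (⟨[v]⟩ : G.HypSyn)) ⊗ₘ η[(⟨Q⟩ : G.HypSyn)]) := by
  rw [← h]
  refine (same_pad_append (S := G.signature) _ P (v :: Q)).trans ?_
  refine (Same.tensor ?_ ?_).trans (Same.tensorHom_assoc _ _ _).symm
  · exact same_pad_congr (S := G.signature) fun x hx => decide_eq_decide.2 (mem_family_left h hx)
  · refine (same_pad_cons_pos (S := G.signature) Q (by simp [family])).trans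
      ((Same.refl _).tensor ?_)
    exact same_pad_false (S := G.signature) fun x hx => by
      simpa using not_mem_family_right h hx

/-- The morphism out of an initial segment that applies the generator of the next vertex. -/
noncomputable def nextGen {P Q : List G.V} {v : G.V} (h : P ++ v :: Q = vertexList G.V) :
    (⟨P⟩ : G.HypSyn) ⟶ ⟨[v]⟩ :=
  proj (S := G.signature) True (fun x : G.V => decide (x ∈ G.parents v)) P ≫
    eqToHom (FreeStr.ext (G.filter_initial h)) ≫ FreeStr.gen (S := G.signature) True v

/-- Padding the graph before `v` is the transpose of deleting the non-parents, so it can be absorbed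
into `nextGen`; only the omni on `Q` stays outside. -/
theorem same_paddedGraph {P Q : List G.V} {v : G.V} (h : P ++ v :: Q = vertexList G.V) :
    Same (G.paddedGraph v) (graph (G.nextGen h) ⊗ₘ η[(⟨Q⟩ : G.HypSyn)]) := by
  have h₁ := (isTranspose_proj_pad (S := G.signature)
    (fun x : G.V => decide (x ∈ G.parents v)) P).graph_comp
      (eqToHom (FreeStr.ext (G.filter_initial h)) ≫ FreeStr.gen (S := G.signature) True v)
  have h₂ : Same (eqToHom (FreeStr.ext (G.filter_initial h)) ≫
      FreeStr.gen (S := G.signature) True v) (FreeStr.gen (S := G.signature) True v) :=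
    Same.eqToHom_comp _ _
  -- The graph is tensored with the identity of the unit so that it composes factorwise with padding
  -- on `P` and `v` and omni on `Q`.
  refine ((h₂.symm.graph.trans (Same.tensorHom_unit _).symm).comp
    ((Same.eqToHom_comp _ _).trans (G.same_pad_family h))).trans ?_
  refine (Same.of_eq (tensorHom_comp_tensorHom _ _ _ _)).trans ?_
  exact Same.tensor (Same.of_eq h₁.symm) (Same.of_eq (Category.id_comp _))

/-- Copy-composing the generators of the vertices in `Q` onto a state of an initial segment amounts
to comparing the state with their graphs. -/
theorem same_comp_copyFrom (P Q : List G.V) (h : P ++ Q = vertexList G.V)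
    (s : 𝟙_ G.HypSyn ⟶ ⟨P⟩) (e : 𝟙_ G.HypSyn ⟶ ⟨vertexList G.V⟩)
    (he : Same e (s ⊗ₘ η[(⟨Q⟩ : G.HypSyn)])) :
    Same (s ≫ G.copyFrom True P Q h) (Y' := ⟨vertexList G.V⟩)
      (conv e (List.prod (α := Conv (𝟙_ G.HypSyn) ⟨vertexList G.V⟩)
        (Q.map G.paddedGraph))) := by
  induction Q generalizing P e with
  | nil =>
    -- With no vertices left, omni is the identity of the unit and the empty product is neutral, so
    -- both sides are `s` up to casts.
    have h₀ : (s ⊗ₘ η[(⟨[]⟩ : G.HypSyn)]) = (s ⊗ₘ 𝟙 (𝟙_ G.HypSyn)) :=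
      congrArg (s ⊗ₘ ·) HypergraphCategory.omni_unit
    refine (Same.comp_eqToHom _ _).trans ?_
    refine ((Same.tensorHom_unit s).symm.trans (Same.of_eq h₀.symm)).trans (he.symm.trans ?_)
    exact Same.of_eq (mul_one (M := Conv (𝟙_ G.HypSyn) ⟨vertexList G.V⟩) e).symm
  | cons v Q ih =>
    -- In the free category the left unitor is an identity by definition; this removes the unitors
    -- from the general convolution lemmas.
    have h₀ {X Y : G.HypSyn} (f : 𝟙_ G.HypSyn ⟶ X) (f' : 𝟙_ G.HypSyn ⟶ Y) :
        (λ_ (𝟙_ G.HypSyn)).inv ≫ (f ⊗ₘ f') = (f ⊗ₘ f') := by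
      rw [leftUnitor_inv_eq]
      exact Category.id_comp _
    have hs : s ≫ G.copyStep True P Q v h =
        conv (s ⊗ₘ η[(⟨[v]⟩ : G.HypSyn)]) (graph (G.nextGen h)) := by
      refine (comp_copy_comp s (G.nextGen h)).trans ?_
      exact congrArg (fun t => conv t (graph (G.nextGen h))) (h₀ _ _)
    -- The extended state again has the shape required by the induction hypothesis. Omni on `v :: Q`
    -- splits: the wire `v` takes part in the comparison with the graph, while the wires of `Q`
    -- remain omni.
    have he' : Same (conv e (G.paddedGraph v))
        ((s ≫ G.copyStep True P Q v h) ⊗ₘ η[(⟨Q⟩ : G.HypSyn)]) := by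
      have h₁ := conv_tensor_omni (⟨Q⟩ : G.HypSyn) (s ⊗ₘ η[(⟨[v]⟩ : G.HypSyn)])
        (graph (G.nextGen h))
      rw [hs]
      refine Same.trans (Same.conv ?_ ((G.same_paddedGraph h).trans (Same.of_eq (h₀ _ _).symm)))
        (Same.of_eq (h₁.trans (h₀ _ _)))
      refine Same.trans ?_ (Same.of_eq (h₀ _ _).symm)
      exact he.trans (((Same.refl s).tensor (same_omni_append [v] Q)).trans
        (Same.tensorHom_assoc _ _ _).symm)
    have hi := ih (P ++ [v]) ((List.append_assoc P [v] Q).trans h) _ _ he'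
    refine Same.trans ?_ (hi.trans (Same.of_eq ?_))
    · refine Same.trans (f := s ≫ G.copyFrom True P (v :: Q) h)
        (((Same.refl _).comp ((Same.refl _).comp (Same.comp_eqToHom _ _)))) ?_
      exact Same.of_eq (Category.assoc _ _ _).symm
    -- Associativity of convolution moves the factor of `v` from the state into the product.
    · exact mul_assoc (G := Conv (𝟙_ G.HypSyn) ⟨vertexList G.V⟩) e (G.paddedGraph v) _

theorem copyComposition_eq :
    G.copyComposition True = (∏ v, G.paddedGraph v : Conv (𝟙_ G.HypSyn) ⟨vertexList G.V⟩) := by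
  -- The recursion starts from the empty state, whose omni extension is the unit of convolution.
  have h := G.same_comp_copyFrom [] (vertexList G.V) rfl (𝟙 _) η[(⟨vertexList G.V⟩ : G.HypSyn)]
    (Same.unit_tensorHom _).symm
  refine (Category.id_comp _).symm.trans (h.eq.trans ?_)
  have h₁ : η[(⟨vertexList G.V⟩ : G.HypSyn)] = (1 : Conv (𝟙_ G.HypSyn) ⟨vertexList G.V⟩) := by
    rw [Conv.one_eq, CopyDiscardCategory.discard_unit]
    exact (Category.id_comp _).symm
  rw [h₁]
  refine (one_mul (M := Conv (𝟙_ G.HypSyn) ⟨vertexList G.V⟩) _).trans ?_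
  -- The list has no repetitions and convolution is commutative, so the ordered product is a product
  -- over the set of vertices.
  refine (List.prod_toFinset (M := Conv (𝟙_ G.HypSyn) ⟨vertexList G.V⟩) G.paddedGraph
    (Finset.sort_nodup (Finset.univ : Finset G.V) (· ≤ ·))).symm.trans ?_
  exact congrArg (fun s : Finset G.V => (∏ v ∈ s, G.paddedGraph v :
    Conv (𝟙_ G.HypSyn) ⟨vertexList G.V⟩)) (Finset.sort_toFinset _ _)

end ODAG

/-! ### Values of `star` and `bang` on generators. -/

namespace OUGr

theorem same_star_map_gen (x : ODAG.point.{u}.V) :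
    Same (star.map (FreeStr.gen (S := ODAG.point.signature) False x))
      (FreeStr.gen (S := point.signature) True pointClique) :=
  Same.eqToHom_comp_eqToHom _ _ _

theorem same_bang_map_gen (H : OUGr.{u}) (C : point.{u}.Clique) :
    Same (H.bang.map (FreeStr.gen (S := point.signature) True C)) H.compareComposition :=
  Same.comp_eqToHom _ _

end OUGr

namespace ODAG

theorem same_bang_map_gen (G : ODAG.{u}) (x : point.{u}.V) :
    Same (G.bang.map (FreeStr.gen (S := point.signature) False x)) (G.copyComposition False) :=
  Same.eqToHom_comp_eqToHom _ _ _

/-! ### Transport of the copy-composition along `star`. -/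

variable (G : ODAG.{u})

theorem star_obj (L : List G.V) : G.star.obj ⟨L⟩ = ⟨L⟩ :=
  liftObj_wires (S := G.signature) (hyp := True) L

theorem same_star_map_gen (v : G.V) :
    Same (G.star.map (FreeStr.gen (S := G.signature) False v))
      (FreeStr.gen (S := G.signature) True v) :=
  Same.eqToHom_comp_eqToHom _ _ _

theorem same_star_map_eqToHom {X Y : G.CDSyn} (h : X = Y) (h' : (⟨X.of⟩ : G.HypSyn) = ⟨Y.of⟩) :
    Same (G.star.map (eqToHom h)) (eqToHom h') := by
  rw [eqToHom_map]
  exact Same.eqToHom _ _ (G.star_obj _)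

/-- The wire deletions are built uniformly in `hyp` from structure that `star` preserves. The same
holds for each step of copy-composition and for the whole recursion in the lemmas below. -/
theorem same_star_map_proj (p : G.V → Bool) (L : List G.V) :
    Same (G.star.map (proj (S := G.signature) False p L)) (proj (S := G.signature) True p L) := by
  induction L with
  | nil => exact (Same.of_eq (G.star.map_id _)).trans (Same.id (G.star_obj []))
  | cons a L ih =>
    by_cases h : p a = true
    · refine ((same_proj_cons_pos (S := G.signature) L h).map G.star.toFunctor).trans
        ((G.star.isCD.map_tensor _ _).trans ?_)
      refine (Same.tensor ?_ ih).trans (same_proj_cons_pos (S := G.signature) L h).symm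
      exact (Same.of_eq (G.star.map_id _)).trans (Same.id (G.star_obj [a]))
    · refine ((same_proj_cons_neg (S := G.signature) L h).map G.star.toFunctor).trans
        ((G.star.isCD.map_tensor _ _).trans ?_)
      refine (Same.tensor ?_ ih).trans (same_proj_cons_neg (S := G.signature) L h).symm
      exact (G.star.isCD.map_delete _).trans (Same.delete (G.star_obj [a]))

theorem same_star_map_copyStep (P Q : List G.V) (v : G.V) (h : P ++ v :: Q = vertexList G.V) :
    Same (G.star.map (G.copyStep False P Q v h)) (G.copyStep True P Q v h) := by
  unfold copyStep
  refine (Same.of_eq (G.star.map_comp _ _)).trans (Same.comp ?_ ?_)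
  · exact (G.star.isCD.map_copy _).trans (Same.copy (G.star_obj P))
  · refine (G.star.isCD.map_tensor _ _).trans (Same.tensor ?_ ?_)
    · exact (Same.of_eq (G.star.map_id _)).trans (Same.id (G.star_obj P))
    · refine (Same.of_eq (G.star.map_comp _ _)).trans (Same.comp (G.same_star_map_proj _ P) ?_)
      exact (Same.of_eq (G.star.map_comp _ _)).trans
        ((G.same_star_map_eqToHom _ _).comp (G.same_star_map_gen v))

theorem same_star_map_copyFrom (P Q : List G.V) (h : P ++ Q = vertexList G.V) :
    Same (G.star.map (G.copyFrom False P Q h)) (G.copyFrom True P Q h) := by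
  induction Q generalizing P with
  | nil => exact G.same_star_map_eqToHom _ _
  | cons v Q ih =>
    refine (Same.of_eq (G.star.map_comp _ _)).trans
      (Same.comp (G.same_star_map_copyStep P Q v h) ?_)
    refine (Same.of_eq (G.star.map_comp _ _)).trans (Same.comp (ih _ _) ?_)
    exact G.same_star_map_eqToHom _ _

theorem same_star_map_copyComposition :
    Same (G.star.map (G.copyComposition False)) (G.copyComposition True) :=
  G.same_star_map_copyFrom [] (vertexList G.V) rfl

/-! ### The moralisation functor on syntax. -/

/-- Two parents of `v` are adjacent because `v` is a common child, and `v` is adjacent to each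
parent by an edge of the original graph. -/
theorem isClique_family (v : G.V) : (moral G).graph.IsClique (G.family v : Set G.V) := by
  intro x hx y hy hne
  refine ⟨hne, ?_⟩
  rcases mem_family.1 (Finset.mem_coe.1 hx) with rfl | ex <;>
    rcases mem_family.1 (Finset.mem_coe.1 hy) with rfl | ey
  · exact absurd rfl hne
  · exact Or.inr (Or.inl ey)
  · exact Or.inl ex
  · exact Or.inr (Or.inr ⟨v, ex, ey⟩)

/-- A vertex together with its parents, as a clique of the moralisation. -/
noncomputable def familyClique (v : G.V) : (moral G).Clique :=
  ⟨G.family v, ⟨v, mem_family.2 (Or.inl rfl)⟩, G.isClique_family v⟩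

open scoped Classical in
/-- The image of the generator of a clique of the moralisation. -/
noncomputable def cliqueState (C : (moral G).Clique) :
    𝟙_ G.HypSyn ⟶ ⟨listOf (V := G.V) C.1⟩ :=
  if h : ∃ v : G.V, C.1 = G.family v then
    graph (FreeStr.gen (S := G.signature) True h.choose) ≫
      eqToHom (FreeStr.ext ((G.listOf_family h.choose).symm.trans
        (congrArg (listOf (V := G.V)) h.choose_spec.symm)))
  else η[(⟨listOf (V := G.V) C.1⟩ : G.HypSyn)]

theorem same_cliqueState_family (C : (moral G).Clique) (v : G.V) (h : C.1 = G.family v) :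
    Same (G.cliqueState C) (graph (FreeStr.gen (S := G.signature) True v)) := by
  have h' : ∃ v : G.V, C.1 = G.family v := ⟨v, h⟩
  rw [cliqueState, dif_pos h']
  refine (Same.comp_eqToHom _ _).trans ?_
  -- The chosen vertex is the given one, since a family determines its vertex.
  rw [G.family_injective (h'.choose_spec.symm.trans h)]
  exact Same.refl _

theorem cliqueState_other (C : (moral G).Clique) (h : ∀ v : G.V, C.1 ≠ G.family v) :
    G.cliqueState C = η[(⟨listOf (V := G.V) C.1⟩ : G.HypSyn)] := by
  rw [cliqueState, dif_neg (not_exists.2 h)]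

/-- The counterpart of `liftObj_wires` with source signature `moral G` and target signature `G`;
only the generating objects are shared. -/
theorem liftObj_moral_wires (L : List G.V) :
    liftObj (S := (moral G).signature) (fun v : G.V => (⟨[v]⟩ : G.HypSyn)) L = ⟨L⟩ := by
  induction L with
  | nil => rfl
  | cons a L ih => exact congrArg ((⟨[a]⟩ : G.HypSyn) ⊗ ·) ih

/-- The moralisation functor on syntax. -/
noncomputable def moralisation : HypergraphFunctor (moral G).Syn G.HypSyn :=
  liftHypergraph (S := (moral G).signature) (fun v : G.V => (⟨[v]⟩ : G.HypSyn)) fun C =>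
    G.cliqueState C ≫ eqToHom (G.liftObj_moral_wires (listOf (V := G.V) C.1)).symm

theorem same_moralisation_map_gen (C : (moral G).Clique) :
    Same (G.moralisation.map (FreeStr.gen (S := (moral G).signature) True C)) (G.cliqueState C) :=
  Same.comp_eqToHom _ _

theorem isMoralisation_moralisation : IsMoralisation G G.moralisation where
  obj _ := rfl
  map_family C v h := (G.same_moralisation_map_gen C).trans (G.same_cliqueState_family C v h)
  map_other C h := (G.same_moralisation_map_gen C).trans (Same.of_eq (G.cliqueState_other C h))

/-- Each clique either is a family or is not, so the defining clauses fix the image of every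
generator. -/
theorem eq_moralisation (m : HypergraphFunctor (moral G).Syn G.HypSyn) (hm : IsMoralisation G m) :
    m = G.moralisation := by
  refine HypergraphFunctor.toFunctor_injective ?_
  refine hypergraphFunctor_eq_of_generators m.isHypergraph G.moralisation.isHypergraph
    (fun v => hm.obj v) fun C => ?_
  by_cases h : ∃ v : G.V, C.1 = G.family v
  · obtain ⟨v, h⟩ := h
    exact (hm.map_family C v h).trans (G.isMoralisation_moralisation.map_family C v h).symm
  · exact (hm.map_other C (not_exists.1 h)).trans
      (G.isMoralisation_moralisation.map_other C (not_exists.1 h)).symm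

theorem moralisation_obj (L : List G.V) : G.moralisation.obj ⟨L⟩ = ⟨L⟩ :=
  G.liftObj_moral_wires L

theorem same_moralisation_map_pad (p : G.V → Bool) (L : List G.V) :
    Same (G.moralisation.map (pad (S := (moral G).signature) p L))
      (pad (S := G.signature) p L) := by
  induction L with
  | nil => exact (Same.of_eq (G.moralisation.map_id _)).trans (Same.id (G.moralisation_obj []))
  | cons a L ih =>
    by_cases h : p a = true
    · refine ((same_pad_cons_pos (S := (moral G).signature) L h).map
        G.moralisation.toFunctor).trans ((G.moralisation.isHypergraph.map_tensor _ _).trans ?_)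
      refine (Same.tensor ?_ ih).trans (same_pad_cons_pos (S := G.signature) L h).symm
      exact (Same.of_eq (G.moralisation.map_id _)).trans (Same.id (G.moralisation_obj [a]))
    · refine ((same_pad_cons_neg (S := (moral G).signature) L h).map
        G.moralisation.toFunctor).trans ((G.moralisation.isHypergraph.map_tensor _ _).trans ?_)
      refine (Same.tensor ?_ ih).trans (same_pad_cons_neg (S := G.signature) L h).symm
      exact (G.moralisation.isHypergraph.map_omni _).trans (Same.omni (G.moralisation_obj [a]))

/-- The vertices of a clique of the moralisation, as vertices of the ordered DAG. -/
abbrev cliqueVertices (C : (moral G).Clique) : Finset G.V := C.1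

/-- The image of the padded generator of a clique of the moralisation. -/
noncomputable def paddedCliqueState (C : (moral G).Clique) :
    𝟙_ G.HypSyn ⟶ ⟨vertexList G.V⟩ :=
  G.cliqueState C ≫
    pad (S := G.signature) (fun x : G.V => decide (x ∈ G.cliqueVertices C)) (vertexList G.V)

theorem same_moralisation_map_paddedGen (C : (moral G).Clique) :
    Same (G.moralisation.map ((moral G).paddedGen C)) (G.paddedCliqueState C) := by
  refine (Same.of_eq (G.moralisation.map_comp _ _)).trans
    ((G.same_moralisation_map_gen C).comp ?_)
  refine (G.same_moralisation_map_pad _ _).trans ?_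
  -- Both predicates decide the same membership, read once in `moral G` and once in `G`.
  exact same_pad_congr (S := G.signature) fun x _ => decide_eq_decide.2 Iff.rfl

theorem paddedCliqueState_family (v : G.V) :
    G.paddedCliqueState (G.familyClique v) = G.paddedGraph v := by
  refine Same.eq (Same.comp (G.same_cliqueState_family _ v rfl) ?_)
  exact Same.symm (Same.eqToHom_comp _ _)

/-- Omni padded by omni is omni everywhere, and this is the unit of convolution because delete on
the unit object is the identity. -/
theorem paddedCliqueState_other (C : (moral G).Clique) (h : ∀ v : G.V, C.1 ≠ G.family v) :
    G.paddedCliqueState C = (1 : Conv (𝟙_ G.HypSyn) ⟨vertexList G.V⟩) := by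
  have h₁ : G.paddedCliqueState C = η[(⟨vertexList G.V⟩ : G.HypSyn)] := by
    rw [paddedCliqueState, G.cliqueState_other C h]
    exact (same_omni_comp_pad (S := G.signature) _ (vertexList G.V)).eq
  rw [h₁, Conv.one_eq, CopyDiscardCategory.discard_unit]
  exact (Category.id_comp _).symm

/-- Families index the non-trivial factors, one for each vertex, so the product over cliques
collapses to the product over vertices. -/
theorem prod_paddedCliqueState [Fintype (moral G).Clique] :
    (∏ C, G.paddedCliqueState C : Conv (𝟙_ G.HypSyn) ⟨vertexList G.V⟩) =
      G.copyComposition True := by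
  classical
  rw [copyComposition_eq]
  have hinj : Function.Injective G.familyClique := fun v x h =>
    G.family_injective (congrArg Subtype.val h)
  -- Cliques outside the image of `familyClique` contribute the unit; on the image, injectivity
  -- permits reindexing by vertices.
  refine (Finset.prod_subset (M := Conv (𝟙_ G.HypSyn) ⟨vertexList G.V⟩)
    (Finset.subset_univ (Finset.univ.image G.familyClique)) fun C _ hC => ?_).symm.trans ?_
  · refine G.paddedCliqueState_other C fun v h => hC ?_
    exact Finset.mem_image.2 ⟨v, Finset.mem_univ _, Subtype.ext h.symm⟩
  · refine (Finset.prod_image (M := Conv (𝟙_ G.HypSyn) ⟨vertexList G.V⟩)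
      fun v _ x _ h => hinj h).trans ?_
    exact Finset.prod_congr (M := Conv (𝟙_ G.HypSyn) ⟨vertexList G.V⟩) rfl
      fun v _ => G.paddedCliqueState_family v

theorem same_moralisation_map_compareComposition :
    Same (G.moralisation.map (moral G).compareComposition) (G.copyComposition True) := by
  classical
  refine (same_map_conv_prod G.moralisation.isHypergraph (X := 𝟙_ (moral G).Syn)
    (Y := ⟨vertexList G.V⟩) (X' := 𝟙_ G.HypSyn) rfl (G.moralisation_obj (vertexList G.V))
    _ _ _ G.same_moralisation_map_paddedGen).trans ?_
  exact Same.of_eq G.prod_paddedCliqueState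

/-- Moralisation takes the compare-composition to the copy-composition. -/
theorem star_bang_moralisation :
    OUGr.star.toFunctor ⋙ (moral G).bang.toFunctor ⋙ G.moralisation.toFunctor =
      G.bang.toFunctor ⋙ G.star.toFunctor := by
  refine cdFunctor_eq_of_generators
    (OUGr.star.isCD.comp ((moral G).bang.isHypergraph.toIsCDFunctor.comp
      G.moralisation.isHypergraph.toIsCDFunctor)) (G.bang.isCD.comp G.star.isCD) ?_ ?_
  · intro _
    -- The trailing `[]` is the unit factor by which `liftObj` ends every tensor product, here that
    -- of the one-element list.
    let L : List G.V := vertexList G.V ++ []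
    exact (G.moralisation_obj L).trans (G.star_obj L).symm
  · intro x
    -- One route takes the generator to the compare-composition, the other to the copy-composition;
    -- both become the copy-composition in the free hypergraph category of `G`.
    have h₁ := ((OUGr.same_star_map_gen x).map (moral G).bang.toFunctor).trans
      ((moral G).same_bang_map_gen OUGr.pointClique)
    have h₂ := (G.same_bang_map_gen x).map G.star.toFunctor
    exact (h₁.map G.moralisation.toFunctor).trans
      (G.same_moralisation_map_compareComposition.trans
        (h₂.trans G.same_star_map_copyComposition).symm)

end ODAG

/-! ### Semantics -/

section Semantics

variable {U : Type w} {G : ODAG.{u}} (F : CDFunctor G.CDSyn (FinStoch U))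

/-- A CD-functor followed by the inclusion is strict monoidal, so its value on a list is the tensor
product of its values on the vertices. This supplies the casts that type the generators in
`hypergraphExtension`. -/
theorem liftObj_stoch (L : List G.V) :
    liftObj (S := G.signature) (fun v : G.V => (F.obj ⟨[v]⟩).obj) L = (F.obj ⟨L⟩).obj := by
  have hF := F.isCD.comp (stochInclusion_isCD U)
  induction L with
  | nil => exact hF.obj_unit.symm
  | cons a L ih =>
    exact (congrArg ((F.obj ⟨[a]⟩).obj ⊗ ·) ih).trans
      (hF.obj_tensor (⟨[a]⟩ : G.CDSyn) ⟨L⟩).symm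

/-- The hypergraph functor with the same values on generators as a CD-functor. -/
noncomputable def hypergraphExtension : HypergraphFunctor G.HypSyn (Mat U) :=
  liftHypergraph (S := G.signature) (fun v : G.V => (F.obj ⟨[v]⟩).obj) fun v =>
    eqToHom (liftObj_stoch F _) ≫ (F.map (FreeStr.gen (S := G.signature) False v)).hom ≫
      eqToHom (liftObj_stoch F _).symm

theorem isHypergraphExtension_hypergraphExtension :
    IsHypergraphExtension F (hypergraphExtension F) := by
  refine cdFunctor_eq_of_generators
    (G.star.isCD.comp (hypergraphExtension F).isHypergraph.toIsCDFunctor)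
    (F.isCD.comp (stochInclusion_isCD U)) (fun v => liftObj_stoch F [v]) fun v => ?_
  exact ((G.same_star_map_gen v).map (hypergraphExtension F).toFunctor).trans
    (Same.eqToHom_comp_eqToHom _ _ _)

/-- Every generator of the free hypergraph category is the image under `star` of a generator of the
free CD-category, so the values on generators are prescribed by `F`. -/
theorem IsHypergraphExtension.unique {F : CDFunctor G.CDSyn (FinStoch U)}
    {K K' : HypergraphFunctor G.HypSyn (Mat U)} (hK : IsHypergraphExtension F K)
    (hK' : IsHypergraphExtension F K') : K = K' := by
  have h : G.star.toFunctor ⋙ K.toFunctor = G.star.toFunctor ⋙ K'.toFunctor := hK.trans hK'.symm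
  refine HypergraphFunctor.toFunctor_injective ?_
  refine hypergraphFunctor_eq_of_generators K.isHypergraph K'.isHypergraph
    (fun v => congrArg (fun T : G.CDSyn ⥤ Mat U => T.obj ⟨[v]⟩) h) fun v => ?_
  have hg : Same ((G.star.toFunctor ⋙ K.toFunctor).map (FreeStr.gen (S := G.signature) False v))
      ((G.star.toFunctor ⋙ K'.toFunctor).map (FreeStr.gen (S := G.signature) False v)) := by
    rw [h]; exact Same.refl _
  exact ((G.same_star_map_gen v).map K.toFunctor).symm.trans
    (hg.trans ((G.same_star_map_gen v).map K'.toFunctor))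

/-- The syntactic square followed by `K` gives an equality of functors into matrices. The product of
the clique potentials is already normalised, and `toProj` is applied only at the end. -/
theorem markovDiagram_moralisation {F : CDFunctor G.CDSyn (FinStoch U)}
    {K : HypergraphFunctor G.HypSyn (Mat U)} (hK : IsHypergraphExtension F K)
    {ω : Distribution.{u} U} (hω : ω.toFunctor = G.bang.toFunctor ⋙ F.toFunctor) :
    MarkovDiagram ω (moral G) (G.moralisation.comp K) := by
  have h : OUGr.star.toFunctor ⋙ (moral G).bang.toFunctor ⋙ (G.moralisation.comp K).toFunctor =
      ω.toFunctor ⋙ stochInclusion U := by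
    rw [hω]
    exact (congrArg (· ⋙ K.toFunctor) G.star_bang_moralisation).trans
      (congrArg (G.bang.toFunctor ⋙ ·) hK)
  exact congrArg (· ⋙ toProj U) h

theorem BN.exists_markovDiagram (B : BN.{u} U) : ∃ Φ, MarkovDiagram B.ω (moral B.G) Φ := by
  obtain ⟨F, hF⟩ := B.factors
  exact ⟨_, markovDiagram_moralisation (isHypergraphExtension_hypergraphExtension F) hF⟩

variable (U) in
/-- Moralisation of Bayesian networks. -/
noncomputable def moralFunctor : BN.{u} U ⥤ MN.{u} U where
  obj B := ⟨B.ω, moral B.G, B.exists_markovDiagram⟩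
  map f := ⟨moralMap f.α, f.τ⟩
  -- `moralMap` keeps the vertex map and the transformation is carried over as it is, so both
  -- functor laws hold by definition.
  map_id _ := rfl
  map_comp _ _ := rfl

end Semantics

end PGM

/-! ### The moralisation theorem. -/

/-- The proofs `fac` are quantified first so that the values of `M` can be displayed as objects. As
`M` is a bound variable, `M.obj B` equals the displayed object only propositionally, hence `Same`
for morphisms. -/
theorem theorem5p2 (U : Type w) :
    (∃ (fac : ∀ B : PGM.BN.{u} U, ∃ Φ, PGM.MarkovDiagram B.ω (PGM.moral B.G) Φ)
       (M : PGM.BN.{u} U ⥤ PGM.MN.{u} U),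
       (∀ B, M.obj B = ⟨B.ω, PGM.moral B.G, fac B⟩) ∧
       ∀ ⦃B B' : PGM.BN.{u} U⦄ (f : B ⟶ B'),
         PGM.Same (X' := (⟨B.ω, PGM.moral B.G, fac B⟩ : PGM.MN.{u} U))
           (Y' := (⟨B'.ω, PGM.moral B'.G, fac B'⟩ : PGM.MN.{u} U))
           (M.map f) ⟨PGM.moralMap f.α, f.τ⟩) ∧
    ∀ G : PGM.ODAG.{u}, ∃ m : PGM.HypergraphFunctor (PGM.moral G).Syn G.HypSyn,
      PGM.IsMoralisation G m ∧ (∀ m', PGM.IsMoralisation G m' → m' = m) ∧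
      PGM.OUGr.star.toFunctor ⋙ (PGM.moral G).bang.toFunctor ⋙ m.toFunctor =
        G.bang.toFunctor ⋙ G.star.toFunctor ∧
      ∀ F : PGM.CDFunctor G.CDSyn (PGM.FinStoch U),
        ∃ Ft : PGM.HypergraphFunctor G.HypSyn (PGM.Mat U),
          PGM.IsHypergraphExtension F Ft ∧ (∀ Ft', PGM.IsHypergraphExtension F Ft' → Ft' = Ft) ∧
          ∀ ω : PGM.Distribution.{u} U, ω.toFunctor = G.bang.toFunctor ⋙ F.toFunctor →
            PGM.MarkovDiagram ω (PGM.moral G) (m.comp Ft) := by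
  refine ⟨⟨fun B => B.exists_markovDiagram, PGM.moralFunctor U, fun _ => rfl,
    fun _ _ _ => PGM.Same.refl _⟩, fun G => ?_⟩
  refine ⟨G.moralisation, G.isMoralisation_moralisation, G.eq_moralisation,
    G.star_bang_moralisation, fun F => ?_⟩
  have hF := PGM.isHypergraphExtension_hypergraphExtension F
  exact ⟨PGM.hypergraphExtension F, hF, fun _ h => h.unique hF,
    fun _ hω => PGM.markovDiagram_moralisation hF hω⟩
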